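/- Let $d\ge 1$, $\alpha\in(0,2)$, $\gamma>1$. For a measurable coefficient $\Lambda:\mathbb R^d\times\mathbb R^d\to[c,C]$, $0<c\le C<\infty$, and a measurable weight $\nu:\mathbb R^d\to[c,C]$ such that $\Lambda(x,y)\nu(x)$ is symmetric in $(x,y)$, the Lévy-type operator $$Lu(x)=\int_{\mathbb R^d}\frac{u(y)-u(x)}{|x-y|^{d+\alpha}}\,\Lambda(x,y)\,dy$$ is understood as the operator in $L^2(\mathbb R^d,\nu)$ associated with its quadratic form on $H^{\alpha/2}(\mathbb R^d)$: $u\in D(L)$ and $Lu=g\in L^2(\mathbb R^d)$ if and only if $u\in H^{\alpha/2}(\mathbb R^d)$ and for all $v\in H^{\alpha/2}(\mathbb R^d)$ $$-\frac12\int_{\mathbb R^d}\int_{\mathbb R^d}\Lambda(x,y)\frac{(u(y)-u(x))(v(y)-v(x))}{|x-y|^{d+\alpha}}\,\nu(x)\,dx\,dy=\int_{\mathbb R^d} g\,v\,\nu\,dx .$$ Here all functions are real valued and $H^{\alpha/2}(\mathbb R^d)$ carries the norm $\|u\|^2=\int u^2+\iint \frac{(u(x)-u(y))^2}{|x-y|^{d+\alpha}}\,dx\,dy$.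 Assume that one of the following two conditions holds for the coefficients $\Lambda^\varepsilon$, $\varepsilon>0$. (P1) $\Lambda^\varepsilon(x,y)=\lambda(x/\varepsilon)\,\mu(y/\varepsilon)$, where $\lambda,\mu$ are measurable, $1$-periodic in each coordinate direction, and $\gamma^{-1}\le\lambda,\mu\le\gamma$. In this case let $\nu^\varepsilon(x)=\mu(x/\varepsilon)/\lambda(x/\varepsilon)$ and $$\Lambda^{\rm eff}(x,y)=\Big(\int_{[0,1]^d}\frac{\mu(\xi)}{\lambda(\xi)}\,d\xi\Big)^{-1}\Big(\int_{[0,1]^d}\mu(\xi)\,d\xi\Big)^2 .$$ (P2) $\Lambda^\varepsilon(x,y)=\Lambda(x,y,x/\varepsilon,y/\varepsilon)$, where $\Lambda(x,y,\xi,\eta)$ is continuous in $(x,y)$, measurable in $(\xi,\eta)$ and $1$-periodic in each coordinate of $\xi$ and $\eta$, with $\Lambda(x,y,\xi,\eta)=\Lambda(y,x,\eta,\xi)$ and $\gamma^{-1}\le\Lambda\le\gamma$ everywhere. In this case let $\nu^\varepsilon=1$ and $$\Lambda^{\rm eff}(x,y)=\int_{[0,1]^d}\int_{[0,1]^d}\Lambda(x,y,\xi,\eta)\,d\xi\,d\eta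 .$$ Let $L^\varepsilon$ be the operator with coefficient $\Lambda^\varepsilon$ and weight $\nu^\varepsilon$, and $L^0$ the operator with coefficient $\Lambda^{\rm eff}$ and weight $1$. Then for every $m>0$ and every $f\in L^2(\mathbb R^d)$ the equations $(L^\varepsilon-m)u^\varepsilon=f$ (for each $\varepsilon>0$) and $(L^0-m)u^0=f$ have unique solutions, and as $\varepsilon\to0^+$ the solutions $u^\varepsilon$ converge to $u^0$ strongly in $L^2(\mathbb R^d)$ and weakly in $H^{\alpha/2}(\mathbb R^d)$. -/

import Mathlib

open MeasureTheory Filter Topology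

noncomputable section

namespace LevyHomogenization

/-- The space `ℝ^d` with its Euclidean norm and Lebesgue measure. -/
abbrev Euc (d : ℕ) : Type := EuclideanSpace ℝ (Fin d)

/-- The real Hilbert space `L²(ℝ^d)`. -/
abbrev L2 (d : ℕ) : Type := Lp ℝ 2 (volume : Measure (Euc d))

/-- The real Hilbert space `L²(ℝ^d × ℝ^d)`. -/
abbrev L2Pair (d : ℕ) : Type := Lp ℝ 2 (volume : Measure (Euc d × Euc d))

/-- The fractional difference quotient `(u(y) - u(x)) / |x - y|^{d/2 + s}`. -/
def fracDiff {d : ℕ} (s : ℝ) (u : Euc d → ℝ) (p : Euc d × Euc d) : ℝ :=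
  (u p.2 - u p.1) / ‖p.1 - p.2‖ ^ ((d : ℝ) / 2 + s)

theorem fracDiff_ae_congr {d : ℕ} (s : ℝ) {u v : Euc d → ℝ} (h : u =ᵐ[volume] v) :
    fracDiff s u =ᵐ[(volume : Measure (Euc d × Euc d))] fracDiff s v := by
  have h1 := (Measure.quasiMeasurePreserving_fst
    (μ := (volume : Measure (Euc d))) (ν := (volume : Measure (Euc d)))).ae_eq_comp h
  have h2 := (Measure.quasiMeasurePreserving_snd
    (μ := (volume : Measure (Euc d))) (ν := (volume : Measure (Euc d)))).ae_eq_comp h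
  rw [← Measure.volume_eq_prod] at h1 h2
  filter_upwards [h1, h2] with p hp1 hp2
  simp only [Function.comp_apply] at hp1 hp2
  simp only [fracDiff, hp1, hp2]

/-- The fractional Sobolev space `H^s(ℝ^d) = W^{s,2}(ℝ^d)` in its Gagliardo form. A function
`u ∈ L²(ℝ^d)` whose fractional difference quotient `D u` is square integrable on `ℝ^d × ℝ^d` is
represented by the pair `(u, D u)`, so that the Hilbert norm inherited from
`L²(ℝ^d) × L²(ℝ^d × ℝ^d)` is the usual one,
`‖u‖² = ∫ u² + ∫∫ (u(x) - u(y))² / |x - y|^{d + 2s}`; see `exists_mem_fracSobolev_iff` and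
`norm_sq_fracSobolev`. -/
def fracSobolev (d : ℕ) (s : ℝ) : Submodule ℝ (WithLp 2 (L2 d × L2Pair d)) where
  carrier := {w | (w.snd : Euc d × Euc d → ℝ) =ᵐ[volume] fracDiff s (w.fst : Euc d → ℝ)}
  zero_mem' := by
    have h := fracDiff_ae_congr s (Lp.coeFn_zero ℝ 2 (volume : Measure (Euc d)))
    refine (Lp.coeFn_zero ℝ 2 (volume : Measure (Euc d × Euc d))).trans ?_
    refine EventuallyEq.trans ?_ h.symm
    exact Eventually.of_forall fun p => by simp [fracDiff]
  add_mem' := by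
    intro a b ha hb
    have h := fracDiff_ae_congr s (Lp.coeFn_add a.fst b.fst)
    have h' := Lp.coeFn_add a.snd b.snd
    simp only [Set.mem_ofPred_eq] at ha hb ⊢
    refine h'.trans (EventuallyEq.trans ?_ h.symm)
    filter_upwards [ha, hb] with p hpa hpb
    simp only [Pi.add_apply, hpa, hpb, fracDiff]
    ring
  smul_mem' := by
    intro c a ha
    have h := fracDiff_ae_congr s (Lp.coeFn_smul c a.fst)
    have h' := Lp.coeFn_smul c a.snd
    simp only [Set.mem_ofPred_eq] at ha ⊢
    refine h'.trans (EventuallyEq.trans ?_ h.symm)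
    filter_upwards [ha] with p hpa
    simp only [Pi.smul_apply, hpa, fracDiff, smul_eq_mul]
    ring

/-- The inclusion `H^s(ℝ^d) ⊂ L²(ℝ^d)`. -/
def toL2 {d : ℕ} {s : ℝ} (u : fracSobolev d s) : L2 d := (u : WithLp 2 (L2 d × L2Pair d)).fst

/-- `toL2` is injective: an element of `H^s` is determined by its class in `L²`. -/
theorem toL2_injective {d : ℕ} {s : ℝ} :
    Function.Injective (toL2 : fracSobolev d s → L2 d) := by
  rintro ⟨u, hu⟩ ⟨v, hv⟩ h
  change u.fst = v.fst at h
  have h2 : u.snd = v.snd := by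
    refine Lp.ext ?_
    have hu' : (u.snd : Euc d × Euc d → ℝ) =ᵐ[volume] fracDiff s (u.fst : Euc d → ℝ) := hu
    have hv' : (v.snd : Euc d × Euc d → ℝ) =ᵐ[volume] fracDiff s (v.fst : Euc d → ℝ) := hv
    rw [h] at hu'
    exact hu'.trans hv'.symm
  refine Subtype.ext ?_
  exact (WithLp.equiv 2 _).injective (Prod.ext h h2)

/-- `u ∈ L²` belongs to `H^s` exactly when its difference quotient is square integrable. -/
theorem exists_mem_fracSobolev_iff {d : ℕ} {s : ℝ} (u : L2 d) :
    (∃ w : fracSobolev d s, toL2 w = u) ↔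
      MemLp (fracDiff s (u : Euc d → ℝ)) 2 (volume : Measure (Euc d × Euc d)) := by
  constructor
  · rintro ⟨⟨w, hw⟩, rfl⟩
    have hw' : (w.snd : Euc d × Euc d → ℝ) =ᵐ[volume] fracDiff s (w.fst : Euc d → ℝ) := hw
    exact (memLp_congr_ae hw').1 (Lp.memLp w.snd)
  · intro h
    exact ⟨⟨WithLp.toLp 2 (u, h.toLp _), h.coeFn_toLp⟩, rfl⟩

/-- The norm of `H^s` is the Gagliardo norm. -/
theorem norm_sq_fracSobolev {d : ℕ} {s : ℝ} (u : fracSobolev d s) :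
    ‖u‖ ^ 2 = (∫ x, toL2 u x ^ 2) +
      ∫ p : Euc d × Euc d, (toL2 u p.2 - toL2 u p.1) ^ 2 / ‖p.1 - p.2‖ ^ ((d : ℝ) + 2 * s) := by
  obtain ⟨w, hw⟩ := u
  have hw' : (w.snd : Euc d × Euc d → ℝ) =ᵐ[volume] fracDiff s (w.fst : Euc d → ℝ) := hw
  have e1 : ‖w.fst‖ ^ 2 = ∫ x, w.fst x ^ 2 := by
    rw [← real_inner_self_eq_norm_sq, L2.inner_def]
    simp [pow_two]
  have e2 : ‖w.snd‖ ^ 2 = ∫ p, w.snd p ^ 2 := by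
    rw [← real_inner_self_eq_norm_sq, L2.inner_def]
    simp [pow_two]
  have e3 : (∫ p, w.snd p ^ 2) = ∫ p : Euc d × Euc d,
      (w.fst p.2 - w.fst p.1) ^ 2 / ‖p.1 - p.2‖ ^ ((d : ℝ) + 2 * s) := by
    refine integral_congr_ae ?_
    filter_upwards [hw'] with p hp
    rw [hp, fracDiff, div_pow, ← Real.rpow_mul_natCast (norm_nonneg _)]
    congr 2
    push_cast
    ring
  change ‖w‖ ^ 2 = _
  rw [WithLp.prod_norm_sq_eq_of_L2, e1, e2, e3]
  rfl

/-- The symmetric bilinear form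
`½ ∫∫ Λ(x,y) (u(y) - u(x)) (v(y) - v(x)) |x - y|^{-d-α} ν(x) dx dy`, which is the form
`(-L u, v)` in the weighted space `L²(ℝ^d, ν)` for
`L u(x) = ∫ Λ(x,y) (u(y) - u(x)) |x - y|^{-d-α} dy` whenever `Λ(x,y) ν(x)` is symmetric. -/
def levyForm {d : ℕ} (α : ℝ) (Λ : Euc d → Euc d → ℝ) (ν : Euc d → ℝ) (u v : Euc d → ℝ) : ℝ :=
  (1 / 2) * ∫ p : Euc d × Euc d,
    Λ p.1 p.2 * ((u p.2 - u p.1) * (v p.2 - v p.1)) / ‖p.1 - p.2‖ ^ ((d : ℝ) + α) * ν p.1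

/-- The graph of the Lévy-type operator `L` with kernel `Λ(x,y) |x - y|^{-d-α}`, realized as the
operator of the form `levyForm` (with form domain `H^{α/2}`) in the weighted space `L²(ℝ^d, ν)`:
`u ∈ D(L)` and `L u = g` if and only if `-form(u, v) = (g, v)_{L²(ν)}` for all `v ∈ H^{α/2}`. -/
def LevyOperatorGraph {d : ℕ} (α : ℝ) (Λ : Euc d → Euc d → ℝ) (ν : Euc d → ℝ)
    (u : fracSobolev d (α / 2)) (g : L2 d) : Prop :=
  ∀ v : fracSobolev d (α / 2), -levyForm α Λ ν (toL2 u) (toL2 v) = ∫ x, g x * toL2 v x * ν x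

/-- `u` solves `(L - m) u = f`: `u` lies in the domain of `L`, and `L u - m u = f` in `L²`. -/
def IsResolventSolution {d : ℕ} (α : ℝ) (Λ : Euc d → Euc d → ℝ) (ν : Euc d → ℝ) (m : ℝ)
    (f : L2 d) (u : fracSobolev d (α / 2)) : Prop :=
  ∃ g : L2 d, LevyOperatorGraph α Λ ν u g ∧ g - m • toL2 u = f

/-- `1`-periodicity in each coordinate direction. -/
def UnitPeriodic {d : ℕ} (h : Euc d → ℝ) : Prop :=
  ∀ (i : Fin d) (ξ : Euc d), h (ξ + EuclideanSpace.single i 1) = h ξ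

/-- The cell `[0,1]^d`. -/
def unitCell (d : ℕ) : Set (Euc d) := {ξ | ∀ i, ξ i ∈ Set.Icc (0 : ℝ) 1}

/-- Product structure. The coefficient is `Λ^ε(x,y) = λ(x/ε) μ(y/ε)`, the symmetrizing weight is
`ν^ε(x) = μ(x/ε) / λ(x/ε)`, and the effective coefficient is the constant
`(∫ μ/λ)⁻¹ (∫ μ)²`, with integrals over the cell. -/
def ProductCase {d : ℕ} (γ : ℝ) (Λε : ℝ → Euc d → Euc d → ℝ) (νε : ℝ → Euc d → ℝ)
    (Λeff : Euc d → Euc d → ℝ) : Prop :=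
  ∃ lam mu : Euc d → ℝ,
    AEMeasurable lam ∧ AEMeasurable mu ∧ UnitPeriodic lam ∧ UnitPeriodic mu ∧
    (∀ ξ, γ⁻¹ ≤ lam ξ ∧ lam ξ ≤ γ) ∧ (∀ η, γ⁻¹ ≤ mu η ∧ mu η ≤ γ) ∧
    (∀ ε x y, Λε ε x y = lam (ε⁻¹ • x) * mu (ε⁻¹ • y)) ∧
    (∀ ε x, νε ε x = mu (ε⁻¹ • x) / lam (ε⁻¹ • x)) ∧
    ∀ x y, Λeff x y =
      (∫ ξ in unitCell d, mu ξ / lam ξ)⁻¹ * (∫ ξ in unitCell d, mu ξ) ^ 2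

/-- Symmetric locally periodic structure. The coefficient is `Λ^ε(x,y) = Λ(x,y,x/ε,y/ε)`, the
weight is `1`, and the effective coefficient is the average of `Λ(x,y,·,·)` over two cells. -/
def LocallyPeriodicCase {d : ℕ} (γ : ℝ) (Λε : ℝ → Euc d → Euc d → ℝ) (νε : ℝ → Euc d → ℝ)
    (Λeff : Euc d → Euc d → ℝ) : Prop :=
  ∃ Λ : Euc d → Euc d → Euc d → Euc d → ℝ,
    (∀ ξ η, Continuous fun p : Euc d × Euc d => Λ p.1 p.2 ξ η) ∧
    (∀ x y, AEMeasurable fun q : Euc d × Euc d => Λ x y q.1 q.2) ∧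
    (∀ x y η, UnitPeriodic fun ξ => Λ x y ξ η) ∧
    (∀ x y ξ, UnitPeriodic fun η => Λ x y ξ η) ∧
    (∀ x y ξ η, Λ x y ξ η = Λ y x η ξ) ∧
    (∀ x y ξ η, γ⁻¹ ≤ Λ x y ξ η ∧ Λ x y ξ η ≤ γ) ∧
    (∀ ε x y, Λε ε x y = Λ x y (ε⁻¹ • x) (ε⁻¹ • y)) ∧
    (∀ ε x, νε ε x = 1) ∧
    ∀ x y, Λeff x y = ∫ η in unitCell d, ∫ ξ in unitCell d, Λ x y ξ η

end LevyHomogenization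

end

open LevyHomogenization

/-!
In `L²(ℝ^d, ν^ε)` the operator `m - L^ε` has the symmetric form
`½ ∫∫ Λ^ε ν^ε Du Dv + m ∫ ν^ε u v`, where `Du` is the fractional difference quotient, and the
coefficients `Λ^ε ν^ε` and `ν^ε` are locally periodic at scale `ε`, so they converge weakly-* to
their cell averages. No corrector is needed: away from the diagonal and from infinity `Dv` is
controlled by `v` in `L²` of a ball, so by Rellich's theorem `v ↦ Dv` is compact there. Hence, for
fixed `u`, the functionals `v ↦ ∫∫ Λ^ε ν^ε Du Dv` converge in the norm of the dual of `H^{α/2}`, and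
uniform coercivity turns this into strong convergence of the solutions in `H^{α/2}`.
-/

noncomputable section

namespace LevyHomogenization

section Caratheodory

variable {P Q : Type*} [TopologicalSpace P] [TopologicalSpace.MetrizableSpace P]
  [SecondCountableTopology P] [MeasurableSpace P] [OpensMeasurableSpace P] [MeasurableSpace Q]
  {μ : Measure Q} {k : P → Q → ℝ}

theorem exists_measurable_uncurry_ae_eq (hc : ∀ q, Continuous fun p => k p q)
    (hm : ∀ p, AEMeasurable (k p) μ) :
    ∃ k' : P → Q → ℝ, Measurable (Function.uncurry k') ∧ ∀ᵐ q ∂μ, ∀ p, k p q = k' p q := by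
  obtain ⟨s, hs, hsd⟩ := TopologicalSpace.exists_countable_dense P
  have hae : ∀ᵐ q ∂μ, ∀ p ∈ s, k p q = (hm p).mk (k p) q :=
    (ae_ball_iff hs).2 fun p _ => (hm p).ae_eq_mk
  obtain ⟨t, hst, htm, ht0⟩ := exists_measurable_superset_of_null (ae_iff.1 hae)
  have hgood : ∀ q ∉ t, ∀ p ∈ s, k p q = (hm p).mk (k p) q := fun q hq =>
    not_not.1 fun h => hq (hst h)
  refine ⟨fun p => tᶜ.indicator (k p), ?_, ?_⟩
  · refine measurable_uncurry_of_continuous_of_measurable (fun q => ?_) (fun p => ?_)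
    · by_cases hq : q ∈ t
      · simpa [hq] using continuous_const
      · simpa [hq] using hc q
    · obtain ⟨a, has, hap⟩ := mem_closure_iff_seq_limit.1 (hsd p)
      refine measurable_of_tendsto_metrizable
        (fun n => (hm (a n)).measurable_mk.indicator htm.compl) (tendsto_pi_nhds.2 fun q => ?_)
      by_cases hq : q ∈ t
      · simp [hq]
      · simp only [Set.mem_compl_iff, hq, not_false_eq_true, Set.indicator_of_mem,
          ← hgood q hq _ (has _)]
        exact ((hc q).tendsto p).comp hap
  · filter_upwards [measure_eq_zero_iff_ae_notMem.1 ht0] with q hq p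
    simp [hq]

theorem aemeasurable_comp_of_continuous_of_aemeasurable {W : Type*} [MeasurableSpace W]
    {ρ : Measure W} (hc : ∀ q, Continuous fun p => k p q) (hm : ∀ p, AEMeasurable (k p) μ)
    {f : W → P} (hf : Measurable f) {g : W → Q} (hg : Measure.QuasiMeasurePreserving g ρ μ) :
    AEMeasurable (fun w => k (f w) (g w)) ρ := by
  obtain ⟨k', hk', hkk'⟩ := exists_measurable_uncurry_ae_eq hc hm
  refine ⟨fun w => k' (f w) (g w), hk'.comp (hf.prodMk hg.measurable), ?_⟩
  filter_upwards [hg.ae hkk'] with w hw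
  exact hw (f w)

theorem aestronglyMeasurable_setIntegral [SFinite μ] (hc : ∀ q, Continuous fun p => k p q)
    (hm : ∀ p, AEMeasurable (k p) μ) (Y : Set Q) (ρ : Measure P) :
    AEStronglyMeasurable (fun p => ∫ q in Y, k p q ∂μ) ρ :=
  (aemeasurable_comp_of_continuous_of_aemeasurable hc
    (fun p => (hm p).restrict) measurable_fst
    Measure.quasiMeasurePreserving_snd).aestronglyMeasurable.integral_prod_right'

end Caratheodory

section Modulus

theorem abs_sub_le_two_mul {Z : Type*} {f : Z → ℝ} {M : ℝ} (hb : ∀ z, |f z| ≤ M) (x y : Z) :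
    |f x - f y| ≤ 2 * M := by
  linarith [abs_sub (f x) (f y), hb x, hb y]

variable {Z : Type*} [PseudoMetricSpace Z]

/-- The modulus of continuity of `f` at distance `δ`, meaningful for bounded `f` only: an unbounded
supremum is `0`. -/
def modulus (f : Z → ℝ) (δ : ℝ) : ℝ :=
  ⨆ x : {x : Z × Z // dist x.1 x.2 < δ}, |f x.1.1 - f x.1.2|

theorem modulus_nonneg (f : Z → ℝ) (δ : ℝ) : 0 ≤ modulus f δ :=
  Real.iSup_nonneg fun _ => abs_nonneg _

theorem modulus_le {f : Z → ℝ} {M : ℝ} (hM : 0 ≤ M) (hb : ∀ z, |f z| ≤ M) (δ : ℝ) :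
    modulus f δ ≤ 2 * M :=
  Real.iSup_le (fun x => abs_sub_le_two_mul hb _ _) (by positivity)

theorem abs_sub_le_modulus {f : Z → ℝ} {M δ : ℝ} (hb : ∀ z, |f z| ≤ M) {x y : Z}
    (hxy : dist x y < δ) : |f x - f y| ≤ modulus f δ :=
  le_ciSup (f := fun x : {x : Z × Z // dist x.1 x.2 < δ} => |f x.1.1 - f x.1.2|)
    ⟨2 * M, Set.forall_mem_range.2 fun _ => abs_sub_le_two_mul hb _ _⟩ ⟨(x, y), hxy⟩

theorem tendsto_modulus {f : Z → ℝ} (hf : UniformContinuous f) :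
    Tendsto (modulus f) (𝓝[>] 0) (𝓝 0) := by
  rw [Metric.tendsto_nhdsWithin_nhds]
  intro η hη
  obtain ⟨ρ, hρ, hfρ⟩ := Metric.uniformContinuous_iff.1 hf (η / 2) (half_pos hη)
  refine ⟨ρ, hρ, fun {δ} _ hδ => ?_⟩
  rw [Real.dist_0_eq_abs] at hδ ⊢
  rw [abs_of_nonneg (modulus_nonneg f δ)]
  refine (Real.iSup_le (fun x => ?_) (half_pos hη).le).trans_lt (half_lt_self hη)
  exact (hfρ (x.2.trans ((le_abs_self δ).trans_lt hδ))).le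

theorem aemeasurable_modulus [SecondCountableTopology Z] {Q : Type*} [MeasurableSpace Q]
    {μ : Measure Q} {k : Z → Q → ℝ} (hc : ∀ q, Continuous fun p => k p q)
    (hm : ∀ p, AEMeasurable (k p) μ) (δ : ℝ) :
    AEMeasurable (fun q => modulus (fun p => k p q) δ) μ := by
  obtain ⟨s, hs, hsd⟩ :=
    TopologicalSpace.exists_countable_dense {x : Z × Z // dist x.1 x.2 < δ}
  have := hs.to_subtype
  have hsup : ∀ q, modulus (fun p => k p q) δ = ⨆ x : s, |k x.1.1.1 q - k x.1.1.2 q| :=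
    fun q => (hsd.ciSup' (((hc q).comp (by fun_prop)).sub ((hc q).comp (by fun_prop))).abs).symm
  simp only [hsup]
  exact AEMeasurable.iSup fun x => ((hm _).sub (hm _)).abs

end Modulus

section WeakStar

theorem norm_smul_le_of_mul_le {E : Type*} [SeminormedAddCommGroup E] [NormedSpace ℝ E] {τ : E}
    {ε C η : ℝ} (hτ : ‖τ‖ ≤ C) (hε : 0 ≤ ε) (hεC : ε * C ≤ η) :
    ‖ε • τ‖ ≤ η := by
  rw [norm_smul, Real.norm_of_nonneg hε]
  exact (mul_le_mul_of_nonneg_left hτ hε).trans hεC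

section Density

variable {X : Type*} [MeasurableSpace X] {μ : Measure X} {M : ℝ}

theorem abs_integral_mul_sub_le {G g a : X → ℝ} (hG : Integrable G μ) (hg : Integrable g μ)
    (hm : AEStronglyMeasurable a μ) (hM : ∀ x, |a x| ≤ M) :
    |∫ x, G x * a x ∂μ - ∫ x, g x * a x ∂μ| ≤ (∫ x, ‖G x - g x‖ ∂μ) * M := by
  rw [← integral_sub (hG.mul_bdd hm (Eventually.of_forall hM))
    (hg.mul_bdd hm (Eventually.of_forall hM)), ← integral_mul_const]
  rw [← Real.norm_eq_abs]
  refine norm_integral_le_of_norm_le ((hG.sub hg).norm.mul_const M)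
    (Eventually.of_forall fun x => ?_)
  rw [← sub_mul, norm_mul]
  exact mul_le_mul_of_nonneg_left (hM x) (norm_nonneg _)

theorem tendsto_integral_mul_of_hasCompactSupport [TopologicalSpace X] [NormalSpace X]
    [R1Space X] [WeaklyLocallyCompactSpace X] [BorelSpace X] [μ.Regular]
    {ι : Type*} {l : Filter ι}
    {a : ι → X → ℝ} {a₀ : X → ℝ} (hm : ∀ᶠ i in l, AEStronglyMeasurable (a i) μ)
    (hm₀ : AEStronglyMeasurable a₀ μ) (hM : ∀ i x, |a i x| ≤ M) (hM₀ : ∀ x, |a₀ x| ≤ M)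
    (h : ∀ g : X → ℝ, Continuous g → HasCompactSupport g →
      Tendsto (fun i => ∫ x, g x * a i x ∂μ) l (𝓝 (∫ x, g x * a₀ x ∂μ)))
    {G : X → ℝ} (hG : Integrable G μ) :
    Tendsto (fun i => ∫ x, G x * a i x ∂μ) l (𝓝 (∫ x, G x * a₀ x ∂μ)) := by
  refine Metric.tendsto_nhds.2 fun e he => ?_
  obtain ⟨g, hgs, hgG, hgc, hgi⟩ :=
    hG.exists_hasCompactSupport_integral_sub_le (ε := e / (3 * (|M| + 1))) (by positivity)
  have hclose : (∫ x, ‖G x - g x‖ ∂μ) * M < e / 3 := by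
    calc (∫ x, ‖G x - g x‖ ∂μ) * M ≤ (∫ x, ‖G x - g x‖ ∂μ) * |M| := by
          gcongr
          exact le_abs_self M
      _ ≤ e / (3 * (|M| + 1)) * |M| := by gcongr
      _ < e / 3 := by
        rw [div_mul_eq_mul_div, div_lt_div_iff₀ (by positivity) (by positivity)]
        nlinarith [abs_nonneg M]
  filter_upwards [Metric.tendsto_nhds.1 (h g hgc hgs) (e / 3) (by positivity), hm] with i hi hmi
  have h1 := (abs_integral_mul_sub_le hG hgi hmi (hM i)).trans_lt hclose
  have h2 := (abs_integral_mul_sub_le hG hgi hm₀ hM₀).trans_lt hclose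
  rw [Real.dist_eq] at hi ⊢
  rw [abs_sub_lt_iff] at *
  constructor <;> linarith

end Density

section LocallyPeriodic

variable {Z : Type*} [NormedAddCommGroup Z] [MeasurableSpace Z]

/-- `Y` is an averaging cell for the set of periods `Γ`: it is bounded and measurable, has unit
mass, and every `Γ`-periodic function has the same average over all translates of `Y`. -/
structure IsAveragingCell (μ : Measure Z) (Γ Y : Set Z) : Prop where
  bounded : Bornology.IsBounded Y
  measurableSet : MeasurableSet Y
  mass : μ Y = 1
  average : ∀ h : Z → ℝ, (∀ g ∈ Γ, ∀ z, h (z + g) = h z) →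
    ∀ z, ∫ τ in Y, h (z + τ) ∂μ = ∫ τ in Y, h τ ∂μ

/-- A locally periodic function `k p q` of a slow variable `p` and a fast variable `q`, whose
rescalings `p ↦ k p (p / ε)` are to be homogenized: continuous in `p`, measurable and `Γ`-periodic
in `q`, bounded by `M`. -/
structure IsLocallyPeriodic (μ : Measure Z) (Γ : Set Z) (M : ℝ) (k : Z → Z → ℝ) : Prop where
  continuous : ∀ q, Continuous fun p => k p q
  aemeasurable : ∀ p, AEMeasurable (k p) μ
  periodic : ∀ p, ∀ g ∈ Γ, ∀ q, k p (q + g) = k p q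
  abs_le : ∀ p q, |k p q| ≤ M

variable {μ : Measure Z} {Γ Y : Set Z} {M : ℝ} {k : Z → Z → ℝ}

theorem IsAveragingCell.isProbabilityMeasure (hY : IsAveragingCell μ Γ Y) :
    IsProbabilityMeasure (μ.restrict Y) :=
  ⟨by simp [hY.mass]⟩

theorem IsLocallyPeriodic.bound_nonneg (hk : IsLocallyPeriodic μ Γ M k) : 0 ≤ M :=
  (abs_nonneg _).trans (hk.abs_le 0 0)

theorem IsLocallyPeriodic.abs_average_le (hk : IsLocallyPeriodic μ Γ M k)
    (hY : IsAveragingCell μ Γ Y) (p : Z) : |∫ q in Y, k p q ∂μ| ≤ M := by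
  have := hY.isProbabilityMeasure
  simpa [hY.mass, measureReal_def] using
    norm_setIntegral_le_of_norm_le_const (μ := μ) (f := k p) (s := Y) (by simp [hY.mass])
      fun q _ => hk.abs_le p q

theorem IsLocallyPeriodic.le_average (hk : IsLocallyPeriodic μ Γ M k)
    (hY : IsAveragingCell μ Γ Y) {c : ℝ} (hc : ∀ p q, c ≤ k p q) (p : Z) :
    c ≤ ∫ q in Y, k p q ∂μ := by
  have := hY.isProbabilityMeasure
  have hint : IntegrableOn (k p) Y μ :=
    Integrable.of_bound (hk.aemeasurable p).restrict.aestronglyMeasurable M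
      (Eventually.of_forall fun q => hk.abs_le p q)
  simpa using integral_mono (integrable_const c) hint (hc p)

theorem IsLocallyPeriodic.mul_left (hk : IsLocallyPeriodic μ Γ M k) {g : Z → ℝ}
    (hg : Continuous g) {N : ℝ} (hgN : ∀ p, |g p| ≤ N) :
    IsLocallyPeriodic μ Γ (N * M) fun p q => g p * k p q where
  continuous q := hg.mul (hk.continuous q)
  aemeasurable p := (hk.aemeasurable p).const_mul _
  periodic p γ hγ q := by simp only [hk.periodic p γ hγ q]
  abs_le p q := by
    rw [abs_mul]
    exact mul_le_mul (hgN p) (hk.abs_le p q) (abs_nonneg _) ((abs_nonneg _).trans (hgN p))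

theorem IsLocallyPeriodic.translate (hk : IsLocallyPeriodic μ Γ M k) (a : Z) :
    IsLocallyPeriodic μ Γ M fun p q => k (p - a) q where
  continuous q := (hk.continuous q).comp (continuous_sub_right a)
  aemeasurable p := hk.aemeasurable (p - a)
  periodic p := hk.periodic (p - a)
  abs_le p := hk.abs_le (p - a)

theorem isLocallyPeriodic_modulus [SecondCountableTopology Z] (hk : IsLocallyPeriodic μ Γ M k)
    (δ : ℝ) : IsLocallyPeriodic μ Γ (2 * M) fun _ q => modulus (fun p => k p q) δ where
  continuous _ := continuous_const
  aemeasurable _ := aemeasurable_modulus hk.continuous hk.aemeasurable δ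
  periodic _ γ hγ q := by simp only [hk.periodic _ γ hγ q]
  abs_le _ q := by
    rw [abs_of_nonneg (modulus_nonneg _ _)]
    exact modulus_le hk.bound_nonneg (fun p => hk.abs_le p q) δ

theorem IsAveragingCell.tendsto_setIntegral_modulus [SecondCountableTopology Z]
    (hY : IsAveragingCell μ Γ Y) (hk : IsLocallyPeriodic μ Γ M k)
    (huc : ∀ q, UniformContinuous fun p => k p q) :
    Tendsto (fun δ => ∫ q in Y, modulus (fun p => k p q) δ ∂μ) (𝓝[>] 0) (𝓝 0) := by
  have := hY.isProbabilityMeasure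
  have hmod := isLocallyPeriodic_modulus hk
  simpa using tendsto_integral_filter_of_dominated_convergence (μ := μ.restrict Y) (fun _ => 2 * M)
    (Eventually.of_forall fun δ => ((hmod δ).aemeasurable 0).restrict.aestronglyMeasurable)
    (Eventually.of_forall fun δ => Eventually.of_forall ((hmod δ).abs_le 0))
    (integrable_const _) (Eventually.of_forall fun q => tendsto_modulus (huc q))

theorem IsLocallyPeriodic.abs_sub_translate_le (hk : IsLocallyPeriodic μ Γ M k) {R : ℝ}
    (hR : ∀ p ∉ Metric.closedBall (0 : Z) R, ∀ q, k p q = 0) {a : Z} {δ : ℝ} (ha : ‖a‖ < δ)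
    (hδ : δ ≤ 1) (p q : Z) :
    |k p q - k (p - a) q| ≤
      (Metric.closedBall (0 : Z) (R + 1)).indicator 1 p * modulus (fun x => k x q) δ := by
  by_cases hp : p ∈ Metric.closedBall (0 : Z) (R + 1)
  · rw [Set.indicator_of_mem hp, Pi.one_apply, one_mul]
    exact abs_sub_le_modulus (fun x => hk.abs_le x q) (by simpa using ha)
  · have hp' : R + 1 < ‖p‖ := by simpa using hp
    have h1 : p ∉ Metric.closedBall (0 : Z) R := by
      simpa using (by linarith : R < ‖p‖)
    have h2 : p - a ∉ Metric.closedBall (0 : Z) R := by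
      simpa using (by linarith [norm_sub_norm_le p a] : R < ‖p - a‖)
    simp [hR p h1, hR _ h2, hp]

end LocallyPeriodic

variable {Z : Type*} [NormedAddCommGroup Z] [NormedSpace ℝ Z] [FiniteDimensional ℝ Z]
  [MeasurableSpace Z] [BorelSpace Z] {μ : Measure Z} [μ.IsAddHaarMeasure] {Γ Y : Set Z}
  {M : ℝ} {k : Z → Z → ℝ} {ε : ℝ}

theorem quasiMeasurePreserving_smul_add {ρ : Measure Z} [SFinite ρ] (hρ : ρ ≪ μ) (c : ℝ) :
    Measure.QuasiMeasurePreserving (fun x : Z × Z => c • x.1 + x.2) (μ.prod ρ) μ :=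
  QuasiMeasurePreserving.prod_of_right (by fun_prop) (Eventually.of_forall fun p =>
    (quasiMeasurePreserving_add_left μ (c • p)).mono_left hρ)

theorem IsAveragingCell.integral_average (hY : IsAveragingCell μ Γ Y)
    (hk : IsLocallyPeriodic μ Γ M k) {g : Z → ℝ} (hg : Integrable g μ) (c : ℝ) :
    Integrable (fun τ => ∫ p, g p * k p (c • p + τ) ∂μ) (μ.restrict Y) ∧
      ∫ τ in Y, ∫ p, g p * k p (c • p + τ) ∂μ ∂μ = ∫ p, g p * ∫ q in Y, k p q ∂μ ∂μ := by
  have := hY.isProbabilityMeasure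
  have hm : AEMeasurable (fun x : Z × Z => k x.1 (c • x.1 + x.2)) (μ.prod (μ.restrict Y)) :=
    aemeasurable_comp_of_continuous_of_aemeasurable hk.continuous hk.aemeasurable measurable_fst
      (quasiMeasurePreserving_smul_add Measure.absolutelyContinuous_restrict c)
  have hint : Integrable (fun x : Z × Z => g x.1 * k x.1 (c • x.1 + x.2))
      (μ.prod (μ.restrict Y)) :=
    (hg.comp_fst _).mul_bdd hm.aestronglyMeasurable (Eventually.of_forall fun x => hk.abs_le _ _)
  refine ⟨hint.integral_prod_right, ?_⟩
  rw [← integral_integral_swap hint]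
  simp only [integral_const_mul, hY.average _ (hk.periodic _)]

theorem IsLocallyPeriodic.aemeasurable_rescaled (hk : IsLocallyPeriodic μ Γ M k) (hε : ε ≠ 0) :
    AEMeasurable (fun p => k p (ε⁻¹ • p)) μ :=
  aemeasurable_comp_of_continuous_of_aemeasurable hk.continuous hk.aemeasurable measurable_id
    (Measure.quasiMeasurePreserving_smul μ (inv_ne_zero hε))

theorem IsLocallyPeriodic.integrable_rescaled (hk : IsLocallyPeriodic μ Γ M k) (hε : ε ≠ 0)
    {g : Z → ℝ} (hg : Integrable g μ) : Integrable (fun p => g p * k p (ε⁻¹ • p)) μ :=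
  hg.mul_bdd (hk.aemeasurable_rescaled hε).aestronglyMeasurable
    (Eventually.of_forall fun _ => hk.abs_le _ _)

theorem integrable_indicator_closedBall_one (R : ℝ) :
    Integrable ((Metric.closedBall (0 : Z) R).indicator (1 : Z → ℝ)) μ :=
  (integrable_indicator_iff measurableSet_closedBall).2
    (integrableOn_const measure_closedBall_lt_top.ne)

theorem IsAveragingCell.setIntegral_rescaled_le (hY : IsAveragingCell μ Γ Y) {C : ℝ}
    (hC : ∀ τ ∈ Y, ‖τ‖ ≤ C) {ω : Z → ℝ} (hω : IsLocallyPeriodic μ Γ M fun _ => ω)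
    (h0 : ∀ q, 0 ≤ ω q) (hε : 0 < ε) (hεC : ε * C ≤ 1) (R : ℝ) :
    ∫ p in Metric.closedBall 0 R, ω (ε⁻¹ • p) ∂μ ≤
      μ.real (Metric.closedBall 0 (R + 1)) * ∫ q in Y, ω q ∂μ := by
  have := hY.isProbabilityMeasure
  set B := Metric.closedBall (0 : Z) (R + 1)
  have hg : Integrable (B.indicator (1 : Z → ℝ)) μ := integrable_indicator_closedBall_one _
  obtain ⟨hint, havg⟩ := hY.integral_average hω hg ε⁻¹
  have hle : ∀ τ ∈ Y, ∫ p in Metric.closedBall 0 R, ω (ε⁻¹ • p) ∂μ ≤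
      ∫ p, B.indicator 1 p * ω (ε⁻¹ • p + τ) ∂μ := by
    intro τ hτ
    have hετ := norm_smul_le_of_mul_le (hC τ hτ) hε.le hεC
    rw [← integral_indicator measurableSet_closedBall,
      ← integral_sub_right_eq_self (fun p => B.indicator 1 p * ω (ε⁻¹ • p + τ)) (ε • τ)]
    simp only [smul_sub, inv_smul_smul₀ hε.ne', sub_add_cancel]
    refine integral_mono_of_nonneg
      (Eventually.of_forall fun p => Set.indicator_nonneg (fun _ _ => h0 _) p)
      (hω.integrable_rescaled hε.ne' (hg.comp_sub_right _)) (Eventually.of_forall fun p => ?_)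
    by_cases hp : p ∈ Metric.closedBall 0 R
    · have hpB : p - ε • τ ∈ B := by
        rw [mem_closedBall_zero_iff] at hp ⊢
        linarith [norm_sub_le p (ε • τ)]
      simp [hp, hpB]
    · rw [Set.indicator_of_notMem hp]
      exact mul_nonneg (Set.indicator_nonneg (fun _ _ => zero_le_one) _) (h0 _)
  calc ∫ p in Metric.closedBall 0 R, ω (ε⁻¹ • p) ∂μ
      ≤ ∫ τ in Y, ∫ p, B.indicator 1 p * ω (ε⁻¹ • p + τ) ∂μ ∂μ :=
        (convex_Ici _).integral_mem isClosed_Ici (ae_restrict_of_forall_mem hY.measurableSet hle)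
          hint
    _ = ∫ p, B.indicator 1 p * ∫ q in Y, ω q ∂μ ∂μ := havg
    _ = μ.real B * ∫ q in Y, ω q ∂μ := by
      rw [integral_mul_const, integral_indicator_one measurableSet_closedBall]

theorem IsAveragingCell.abs_integral_rescaled_sub_le (hY : IsAveragingCell μ Γ Y) {C : ℝ}
    (hC : ∀ τ ∈ Y, ‖τ‖ ≤ C) (hk : IsLocallyPeriodic μ Γ M k) {R : ℝ}
    (hR : ∀ p ∉ Metric.closedBall (0 : Z) R, ∀ q, k p q = 0) {δ : ℝ} (hε : 0 < ε)
    (hεC : ε * C < δ) (hδ : δ ≤ 1) :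
    |∫ p, k p (ε⁻¹ • p) ∂μ - ∫ p, ∫ q in Y, k p q ∂μ ∂μ| ≤
      ∫ p in Metric.closedBall 0 (R + 1), modulus (fun x => k x (ε⁻¹ • p)) δ ∂μ := by
  have := hY.isProbabilityMeasure
  have hg : Integrable ((Metric.closedBall (0 : Z) R).indicator (1 : Z → ℝ)) μ :=
    integrable_indicator_closedBall_one R
  have hgk : ∀ p q, (Metric.closedBall (0 : Z) R).indicator 1 p * k p q = k p q := by
    intro p q
    by_cases hp : p ∈ Metric.closedBall (0 : Z) R
    · simp [Set.indicator_of_mem hp]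
    · rw [hR p hp q, mul_zero]
  obtain ⟨hint, havg⟩ := hY.integral_average hk hg ε⁻¹
  simp only [← integral_const_mul, hgk] at hint havg
  have hk0 : Integrable (fun p => k p (ε⁻¹ • p)) μ := by
    simpa only [hgk] using hk.integrable_rescaled hε.ne' hg
  have hkτ : ∀ a, Integrable (fun p => k (p - a) (ε⁻¹ • p)) μ := fun a => by
    simpa only [hgk] using (hk.translate a).integrable_rescaled hε.ne' (hg.comp_sub_right a)
  have hind : ∀ p, (Metric.closedBall (0 : Z) (R + 1)).indicator 1 p *
      modulus (fun x => k x (ε⁻¹ • p)) δ = (Metric.closedBall (0 : Z) (R + 1)).indicator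
        (fun p => modulus (fun x => k x (ε⁻¹ • p)) δ) p := fun p => by
    by_cases hp : p ∈ Metric.closedBall (0 : Z) (R + 1) <;> simp only [hp, not_false_eq_true,
      Set.indicator_of_mem, Set.indicator_of_notMem, Pi.one_apply, one_mul, zero_mul]
  rw [← havg, ← Real.dist_eq, dist_comm, ← Metric.mem_closedBall]
  refine (convex_closedBall _ _).integral_mem Metric.isClosed_closedBall
    (ae_restrict_of_forall_mem hY.measurableSet fun τ hτ => ?_) hint
  have hετ : ‖ε • τ‖ < δ :=
    (norm_smul_le_of_mul_le (hC τ hτ) hε.le le_rfl).trans_lt hεC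
  rw [← integral_sub_right_eq_self (fun p => k p (ε⁻¹ • p + τ)) (ε • τ)]
  simp only [smul_sub, inv_smul_smul₀ hε.ne', sub_add_cancel]
  rw [Metric.mem_closedBall, dist_comm, Real.dist_eq, ← integral_sub hk0 (hkτ _),
    ← integral_indicator measurableSet_closedBall, ← Real.norm_eq_abs]
  refine norm_integral_le_of_norm_le ?_ (Eventually.of_forall fun p =>
    (hk.abs_sub_translate_le hR hετ hδ p (ε⁻¹ • p)).trans_eq (hind p))
  simpa only [hind] using (isLocallyPeriodic_modulus hk δ).integrable_rescaled hε.ne'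
    (integrable_indicator_closedBall_one (R + 1))

theorem IsAveragingCell.tendsto_integral_rescaled_of_support
    (hY : IsAveragingCell μ Γ Y) (hk : IsLocallyPeriodic μ Γ M k) {R : ℝ}
    (hR : ∀ p ∉ Metric.closedBall (0 : Z) R, ∀ q, k p q = 0) :
    Tendsto (fun ε : ℝ => ∫ p, k p (ε⁻¹ • p) ∂μ) (𝓝[>] 0) (𝓝 (∫ p, ∫ q in Y, k p q ∂μ ∂μ)) := by
  obtain ⟨C, hC0, hC⟩ := hY.bounded.exists_pos_norm_le
  have huc : ∀ q, UniformContinuous fun p => k p q := fun q =>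
    (HasCompactSupport.intro (isCompact_closedBall 0 R) fun p hp =>
      hR p hp q).uniformContinuous_of_continuous (hk.continuous q)
  have hδ : Tendsto (fun ε : ℝ => ε * (C + 1)) (𝓝[>] 0) (𝓝[>] 0) := by
    refine tendsto_nhdsWithin_iff.2 ⟨?_, ?_⟩
    · exact ((continuous_mul_const (C + 1)).tendsto' 0 0 (zero_mul _)).mono_left nhdsWithin_le_nhds
    · filter_upwards [self_mem_nhdsWithin] with ε (hε : 0 < ε)
      exact mul_pos hε (by positivity)
  have hlim := ((hY.tendsto_setIntegral_modulus hk huc).comp hδ).const_mul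
    (μ.real (Metric.closedBall (0 : Z) (R + 1 + 1)))
  rw [mul_zero] at hlim
  rw [tendsto_iff_dist_tendsto_zero]
  refine squeeze_zero' (Eventually.of_forall fun _ => dist_nonneg) ?_ hlim
  filter_upwards [self_mem_nhdsWithin,
    hδ.eventually (mem_nhdsWithin_of_mem_nhds (Iic_mem_nhds one_pos))] with ε (hε : 0 < ε) hε1
  have hεC : ε * C < ε * (C + 1) := by nlinarith
  refine (hY.abs_integral_rescaled_sub_le hC hk hR hε hεC hε1).trans ?_
  exact hY.setIntegral_rescaled_le hC (isLocallyPeriodic_modulus hk _)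
    (fun q => modulus_nonneg _ _) hε (hεC.le.trans hε1) _

theorem IsAveragingCell.tendsto_integral_rescaled
    (hY : IsAveragingCell μ Γ Y) (hk : IsLocallyPeriodic μ Γ M k) {G : Z → ℝ}
    (hG : Integrable G μ) :
    Tendsto (fun ε : ℝ => ∫ p, G p * k p (ε⁻¹ • p) ∂μ) (𝓝[>] 0)
      (𝓝 (∫ p, G p * ∫ q in Y, k p q ∂μ ∂μ)) := by
  have hm : ∀ᶠ ε in 𝓝[>] (0 : ℝ), AEStronglyMeasurable (fun p => k p (ε⁻¹ • p)) μ := by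
    filter_upwards [self_mem_nhdsWithin] with ε (hε : 0 < ε)
    exact (hk.aemeasurable_rescaled hε.ne').aestronglyMeasurable
  refine tendsto_integral_mul_of_hasCompactSupport hm
    (aestronglyMeasurable_setIntegral hk.continuous hk.aemeasurable Y μ)
    (fun ε p => hk.abs_le p _) (hk.abs_average_le hY) (fun g hg hgs => ?_) hG
  obtain ⟨N, hN⟩ := hgs.exists_bound_of_continuous hg
  obtain ⟨R, hR⟩ := hgs.isCompact.isBounded.subset_closedBall (0 : Z)
  have hgR : ∀ p ∉ Metric.closedBall (0 : Z) R, g p = 0 := fun p hp =>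
    image_eq_zero_of_notMem_tsupport fun h => hp (hR h)
  simpa only [integral_const_mul] using
    hY.tendsto_integral_rescaled_of_support (hk.mul_left hg hN) fun p hp q => by
      rw [hgR p hp, zero_mul]

end WeakStar

section Cells

variable {d : ℕ} {δ : ℝ} {k : Fin d → ℤ}

/-- The half-open cell of the cubic grid of step `δ` with index `k`. -/
def gridCell (δ : ℝ) (k : Fin d → ℤ) : Set (Euc d) :=
  {x | ∀ i, x i ∈ Set.Ico (δ * k i) (δ * (k i + 1))}

theorem gridCell_eq_preimage (δ : ℝ) (k : Fin d → ℤ) :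
    gridCell δ k = WithLp.ofLp ⁻¹'
      Set.univ.pi fun i => Set.Ico (δ * (k i : ℝ)) (δ * (k i + 1)) := by
  ext x
  simp [gridCell]

theorem measurableSet_gridCell (δ : ℝ) (k : Fin d → ℤ) : MeasurableSet (gridCell δ k) := by
  rw [gridCell_eq_preimage]
  exact (PiLp.volume_preserving_ofLp (Fin d)).measurable
    (MeasurableSet.univ_pi fun i => measurableSet_Ico)

theorem volume_gridCell (hδ : 0 ≤ δ) (k : Fin d → ℤ) :
    volume (gridCell δ k) = ENNReal.ofReal (δ ^ d) := by
  rw [gridCell_eq_preimage, (PiLp.volume_preserving_ofLp (Fin d)).measure_preimage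
    (MeasurableSet.univ_pi fun i => measurableSet_Ico).nullMeasurableSet, Real.volume_pi_Ico]
  simp [mul_add, ENNReal.ofReal_pow hδ]

theorem norm_sub_le_of_mem_gridCell {x y : Euc d} (hx : x ∈ gridCell δ k)
    (hy : y ∈ gridCell δ k) : ‖x - y‖ ≤ d * δ := by
  have hcoord : ∀ i, |(x - y) i| ≤ δ := fun i => by
    rw [PiLp.sub_apply, abs_le]
    constructor <;> linarith [(hx i).1, (hx i).2, (hy i).1, (hy i).2]
  calc ‖x - y‖ = ‖∑ i, (x - y) i • EuclideanSpace.single i (1 : ℝ)‖ := by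
        conv_lhs => rw [← (EuclideanSpace.basisFun (Fin d) ℝ).sum_repr (x - y)]
        simp
    _ ≤ ∑ i, ‖(x - y) i • EuclideanSpace.single i (1 : ℝ)‖ := norm_sum_le _ _
    _ ≤ ∑ _i : Fin d, δ := Finset.sum_le_sum fun i _ => by simpa [norm_smul] using hcoord i
    _ = d * δ := by simp

/-- The index of the grid cell of step `δ` containing `x`. -/
def cellIndex (δ : ℝ) (x : Euc d) : Fin d → ℤ := fun i => ⌊x i / δ⌋

theorem mem_gridCell_iff (hδ : 0 < δ) {x : Euc d} : x ∈ gridCell δ k ↔ k = cellIndex δ x := by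
  simp only [gridCell, cellIndex, funext_iff]
  refine forall_congr' fun i => ?_
  rw [eq_comm, Int.floor_eq_iff, Set.mem_Ico, le_div_iff₀ hδ, div_lt_iff₀ hδ, mul_comm δ,
    mul_comm δ]

theorem ae_unitCell_eq_gridCell : unitCell d =ᵐ[volume] gridCell (d := d) 1 0 := by
  have h := (PiLp.volume_preserving_ofLp (Fin d)).quasiMeasurePreserving.preimage_ae_eq
    (Measure.pi_Ico_ae_eq_pi_Icc (μ := fun _ : Fin d => volume) (s := Set.univ) (f := 0) (g := 1))
  have e : unitCell d = WithLp.ofLp ⁻¹' Set.Icc (0 : Fin d → ℝ) 1 := by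
    ext x
    simp [unitCell, Pi.le_def, forall_and]
  rw [Set.pi_univ_Icc] at h
  rw [gridCell_eq_preimage, e]
  convert h.symm using 2
  simp

theorem volume_unitCell : volume (unitCell d) = 1 := by
  rw [measure_congr ae_unitCell_eq_gridCell, volume_gridCell zero_le_one]
  simp

theorem isCompact_unitCell : IsCompact (unitCell d) := by
  have e : unitCell d = (EuclideanSpace.equiv (Fin d) ℝ) ⁻¹' Set.Icc 0 1 := by
    ext x
    simp [unitCell, Pi.le_def, forall_and]
  rw [e]
  exact (EuclideanSpace.equiv (Fin d) ℝ).toHomeomorph.isClosedEmbedding.isCompact_preimage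
    isCompact_Icc

theorem add_mem_periods_of_span {Z : Type*} [AddCommGroup Z] {Γ : Set Z} {h : Z → ℝ}
    (hΓ : ∀ g ∈ Γ, ∀ z, h (z + g) = h z) :
    ∀ g ∈ Submodule.span ℤ Γ, ∀ z, h (z + g) = h z := by
  intro g hg
  rw [← Submodule.mem_toAddSubgroup, Submodule.span_int_eq_addSubgroupClosure] at hg
  induction hg using AddSubgroup.closure_induction with
  | mem g hg => exact hΓ g hg
  | zero => simp
  | add g g' _ _ ih ih' => intro z; rw [← add_assoc, ih', ih]
  | neg g _ ih => intro z; rw [← ih (z + -g), neg_add_cancel_right]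

open scoped Pointwise in
theorem isAveragingCell_of_basis {Z : Type*} [NormedAddCommGroup Z] [NormedSpace ℝ Z]
    [FiniteDimensional ℝ Z] [MeasurableSpace Z] [BorelSpace Z] {μ : Measure Z} [μ.IsAddHaarMeasure]
    {ι : Type*} [Finite ι] (b : Module.Basis ι ℝ Z) {Y : Set Z} (hYb : IsCompact Y)
    (hY1 : μ Y = 1) (hY : Y =ᵐ[μ] ZSpan.fundamentalDomain b) :
    IsAveragingCell μ (Set.range b) Y := by
  refine ⟨hYb.isBounded, hYb.measurableSet, hY1, fun h hp z => ?_⟩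
  have hfd := ZSpan.isAddFundamentalDomain' b μ
  have : Countable (Submodule.span ℤ (Set.range b)).toAddSubgroup :=
    inferInstanceAs (Countable (Submodule.span ℤ (Set.range b)))
  have htranslate := (hfd.vadd_of_comm z).setIntegral_eq hfd (f := h) fun g x => by
    rw [AddSubgroup.vadd_def, vadd_eq_add, add_comm]
    exact add_mem_periods_of_span hp g g.2 x
  rw [setIntegral_congr_set hY, setIntegral_congr_set hY, ← htranslate, ← Set.image_vadd]
  exact ((measurePreserving_add_left μ z).setIntegral_image_emb
    (measurableEmbedding_addLeft z) _ _).symm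

theorem gridCell_one_zero_eq_fundamentalDomain : gridCell (d := d) 1 0 =
    ZSpan.fundamentalDomain (EuclideanSpace.basisFun (Fin d) ℝ).toBasis := by
  ext x
  simp [ZSpan.mem_fundamentalDomain, gridCell]

theorem isAveragingCell_unitCell (d : ℕ) :
    IsAveragingCell (volume : Measure (Euc d))
      (Set.range (EuclideanSpace.basisFun (Fin d) ℝ).toBasis) (unitCell d) :=
  isAveragingCell_of_basis _ isCompact_unitCell volume_unitCell
    (gridCell_one_zero_eq_fundamentalDomain ▸ ae_unitCell_eq_gridCell)

theorem UnitPeriodic.add_basis {h : Euc d → ℝ} (hh : UnitPeriodic h) :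
    ∀ g ∈ Set.range (EuclideanSpace.basisFun (Fin d) ℝ).toBasis, ∀ z, h (z + g) = h z := by
  rintro _ ⟨i, rfl⟩ z
  simpa using hh i z

/-- The coordinate directions of `ℝ^d × ℝ^d`. -/
def pairPeriods (d : ℕ) : Set (Euc d × Euc d) :=
  Set.range ((EuclideanSpace.basisFun (Fin d) ℝ).toBasis.prod
    (EuclideanSpace.basisFun (Fin d) ℝ).toBasis)

instance isAddHaarMeasure_volume_prod :
    (volume : Measure (Euc d × Euc d)).IsAddHaarMeasure :=
  inferInstanceAs ((volume : Measure (Euc d)).prod (volume : Measure (Euc d))).IsAddHaarMeasure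

theorem isAveragingCell_pair (d : ℕ) :
    IsAveragingCell (volume : Measure (Euc d × Euc d)) (pairPeriods d)
      (unitCell d ×ˢ unitCell d) := by
  refine isAveragingCell_of_basis _ (isCompact_unitCell.prod isCompact_unitCell) ?_ ?_
  · rw [Measure.volume_eq_prod, Measure.prod_prod, volume_unitCell, one_mul]
  · have e : ZSpan.fundamentalDomain ((EuclideanSpace.basisFun (Fin d) ℝ).toBasis.prod
        (EuclideanSpace.basisFun (Fin d) ℝ).toBasis) = gridCell 1 0 ×ˢ gridCell 1 0 := by
      ext x
      simp [ZSpan.mem_fundamentalDomain, gridCell]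
    rw [e]
    exact Measure.set_prod_ae_eq ae_unitCell_eq_gridCell ae_unitCell_eq_gridCell

theorem add_pairPeriods {h : Euc d × Euc d → ℝ} (h1 : ∀ η, UnitPeriodic fun ξ => h (ξ, η))
    (h2 : ∀ ξ, UnitPeriodic fun η => h (ξ, η)) : ∀ g ∈ pairPeriods d, ∀ z, h (z + g) = h z := by
  rintro _ ⟨i | i, rfl⟩ ⟨ξ, η⟩
  · simpa [Module.Basis.prod_apply] using h1 η i ξ
  · simpa [Module.Basis.prod_apply] using h2 ξ i η

end Cells

section Compactness

variable {E F : Type*} [NormedAddCommGroup E] [NormedSpace ℝ E]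
  [NormedAddCommGroup F] [NormedSpace ℝ F]

theorem isCompactOperator_of_norm_le [CompleteSpace F] {A : E →L[ℝ] F}
    (h : ∀ η > 0, ∃ (G : Type) (_ : NormedAddCommGroup G) (_ : NormedSpace ℝ G) (P : E →L[ℝ] G)
      (C : ℝ), IsCompactOperator P ∧ ∀ v, ‖A v‖ ≤ η * ‖v‖ + C * ‖P v‖) :
    IsCompactOperator A := by
  refine (isCompactOperator_iff_isCompact_closure_image_closedBall (A : E →ₗ[ℝ] F) one_pos).2 ?_
  refine (TotallyBounded.closure ?_).isCompact_of_isClosed isClosed_closure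
  refine Metric.totallyBounded_iff.2 fun r hr => ?_
  obtain ⟨G, _, _, P, C, hP, hAP⟩ := h (r / 4) (by positivity)
  obtain ⟨K, hK, hPK⟩ := hP.image_closedBall_subset_compact (f := (P : E →ₗ[ℝ] G)) 1
  obtain ⟨t, ht, htf, hcover⟩ := Set.exists_subset_image_finite_and.1
    (Metric.finite_approx_of_totallyBounded (hK.totallyBounded.subset hPK)
      (r / (2 * (|C| + 1))) (by positivity))
  refine ⟨A '' t, htf.image A, ?_⟩
  rintro _ ⟨v, hv, rfl⟩
  obtain ⟨_, ⟨w, hw, rfl⟩, hvw⟩ := Set.mem_iUnion₂.1 (hcover (Set.mem_image_of_mem _ hv))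
  refine Set.mem_iUnion₂.2 ⟨A w, Set.mem_image_of_mem _ hw, ?_⟩
  have hPvw : ‖P (v - w)‖ < r / (2 * (|C| + 1)) := by simpa [dist_eq_norm] using hvw
  have hvw2 : ‖v - w‖ ≤ 1 + 1 :=
    norm_sub_le_of_le (mem_closedBall_zero_iff.1 hv) (mem_closedBall_zero_iff.1 (ht hw))
  have hCP : C * ‖P (v - w)‖ < r / 2 :=
    calc C * ‖P (v - w)‖ ≤ (|C| + 1) * ‖P (v - w)‖ := by
          gcongr
          linarith [le_abs_self C]
      _ < (|C| + 1) * (r / (2 * (|C| + 1))) := by gcongr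
      _ = r / 2 := by field_simp
  rw [Metric.mem_ball, dist_eq_norm]
  calc ‖A v - A w‖ = ‖A (v - w)‖ := by rw [map_sub]
    _ ≤ r / 4 * ‖v - w‖ + C * ‖P (v - w)‖ := hAP _
    _ < r := by nlinarith

theorem tendsto_comp_of_isCompactOperator {ι : Type*} {l : Filter ι} {φ : ι → F →L[ℝ] ℝ}
    {φ₀ : F →L[ℝ] ℝ} {M : ℝ} (hφ : ∀ i, ‖φ i‖ ≤ M) (hlim : ∀ g, Tendsto (φ · g) l (𝓝 (φ₀ g)))
    {T : E →L[ℝ] F} (hT : IsCompactOperator T) :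
    Tendsto (fun i => φ i ∘L T) l (𝓝 (φ₀ ∘L T)) := by
  obtain ⟨K, hK, hTK⟩ := hT.image_closedBall_subset_compact (f := (T : E →ₗ[ℝ] F)) 1
  have hequi : Equicontinuous fun i => (φ i : F → ℝ) :=
    (LipschitzWith.uniformEquicontinuous _ M.toNNReal fun i =>
      (φ i).lipschitz.weaken (NNReal.coe_le_coe.1 ((hφ i).trans M.le_coe_toNNReal))).equicontinuous
  have hunif : TendstoUniformlyOn (fun i => (φ i : F → ℝ)) φ₀ l K :=
    UniformOnFun.tendsto_iff_tendstoUniformlyOn.1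
      ((EquicontinuousOn.tendsto_uniformOnFun_iff_pi (𝔖 := {K | IsCompact K}) (fun _ h => h)
        (Set.sUnion_eq_univ_iff.2 fun g => ⟨{g}, isCompact_singleton, rfl⟩)
        (fun K _ => hequi.equicontinuousOn K) l φ₀).2 (tendsto_pi_nhds.2 hlim)) K hK
  refine Metric.tendsto_nhds.2 fun η hη => ?_
  filter_upwards [Metric.tendstoUniformlyOn_iff.1 hunif (η / 2) (half_pos hη)] with i hi
  refine (?_ : _ ≤ η / 2).trans_lt (half_lt_self hη)
  rw [dist_comm, dist_eq_norm]
  refine ContinuousLinearMap.opNorm_le_of_unit_norm (half_pos hη).le fun v hv => ?_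
  exact (hi (T v) (hTK ⟨v, by simp [hv], rfl⟩)).le

theorem tendsto_comp_of_approx {ι : Type*} {l : Filter ι} {φ : ι → F →L[ℝ] ℝ}
    {φ₀ : F →L[ℝ] ℝ} {M : ℝ} (hφ : ∀ i, ‖φ i‖ ≤ M) (hlim : ∀ g, Tendsto (φ · g) l (𝓝 (φ₀ g)))
    {A : E →L[ℝ] F} (hA : ∀ η > 0, ∃ T : E →L[ℝ] F, IsCompactOperator T ∧
      (∀ i, ‖φ i ∘L (A - T)‖ ≤ η) ∧ ‖φ₀ ∘L (A - T)‖ ≤ η) :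
    Tendsto (fun i => φ i ∘L A) l (𝓝 (φ₀ ∘L A)) := by
  refine Metric.tendsto_nhds.2 fun η hη => ?_
  obtain ⟨T, hT, hAT, hAT₀⟩ := hA (η / 4) (by positivity)
  filter_upwards [Metric.tendsto_nhds.1 (tendsto_comp_of_isCompactOperator hφ hlim hT) (η / 2)
    (half_pos hη)] with i hi
  rw [dist_eq_norm] at hi ⊢
  calc ‖φ i ∘L A - φ₀ ∘L A‖
      = ‖φ i ∘L (A - T) + (φ i ∘L T - φ₀ ∘L T) - φ₀ ∘L (A - T)‖ := by
        congr 1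
        ext v
        simp
    _ ≤ ‖φ i ∘L (A - T)‖ + ‖φ i ∘L T - φ₀ ∘L T‖ + ‖φ₀ ∘L (A - T)‖ :=
        (norm_sub_le _ _).trans (add_le_add_left (norm_add_le _ _) _)
    _ < η := by linarith [hAT i]

end Compactness

section Coercive

variable {E : Type*} [NormedAddCommGroup E] [InnerProductSpace ℝ E]

theorem existsUnique_apply_eq_of_isCoercive [CompleteSpace E] {B : E →L[ℝ] E →L[ℝ] ℝ}
    (hB : IsCoercive B) (ℓ : E →L[ℝ] ℝ) : ∃! u, B u = ℓ := by
  have hsol : ∀ u, B u = ℓ ↔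
      hB.continuousLinearEquivOfBilin u = (InnerProductSpace.toDual ℝ E).symm ℓ := fun u => by
    rw [ContinuousLinearMap.ext_iff, ext_iff_inner_right ℝ]
    simp only [hB.continuousLinearEquivOfBilin_apply, InnerProductSpace.toDual_symm_apply]
  simp only [hsol]
  exact hB.continuousLinearEquivOfBilin.bijective.existsUnique _

theorem tendsto_of_coercive {ι : Type*} {l : Filter ι} {B : ι → E →L[ℝ] E →L[ℝ] ℝ}
    {ℓ : ι → E →L[ℝ] ℝ} {ℓ₀ : E →L[ℝ] ℝ} {u : ι → E} {u₀ : E} {c : ℝ} (hc : 0 < c)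
    (hB : ∀ᶠ i in l, ∀ v, c * ‖v‖ ^ 2 ≤ B i v v) (hu : ∀ᶠ i in l, B i (u i) = ℓ i)
    (hBu₀ : Tendsto (B · u₀) l (𝓝 ℓ₀)) (hℓ : Tendsto ℓ l (𝓝 ℓ₀)) : Tendsto u l (𝓝 u₀) := by
  have hres : Tendsto (fun i => c⁻¹ * ‖ℓ i - B i u₀‖) l (𝓝 0) := by
    simpa using ((hℓ.sub hBu₀).norm).const_mul c⁻¹
  rw [tendsto_iff_norm_sub_tendsto_zero]
  refine squeeze_zero' (Eventually.of_forall fun i => norm_nonneg _) ?_ hres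
  filter_upwards [hB, hu] with i hBi hui
  have key : c * ‖u i - u₀‖ ^ 2 ≤ ‖ℓ i - B i u₀‖ * ‖u i - u₀‖ :=
    calc c * ‖u i - u₀‖ ^ 2 ≤ B i (u i - u₀) (u i - u₀) := hBi _
      _ = (ℓ i - B i u₀) (u i - u₀) := by rw [map_sub (B i), hui]
      _ ≤ ‖ℓ i - B i u₀‖ * ‖u i - u₀‖ := (le_abs_self _).trans ((ℓ i - B i u₀).le_opNorm _)
  rw [le_inv_mul_iff₀ hc]
  rcases (norm_nonneg (u i - u₀)).eq_or_lt with h | h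
  · rw [← h, mul_zero]
    exact norm_nonneg _
  · exact le_of_mul_le_mul_right (by linarith) h

end Coercive

section Multiplication

open scoped ENNReal

variable {X : Type*} [MeasurableSpace X] {μ : Measure X} {a : X → ℝ} {M : ℝ} {S : Set X}

open Classical in
/-- Multiplication by the bounded function `a`, as an operator on `L²`. It is set to `0` when `a`
is not in `L^∞`, which makes it a total function of `a`. -/
def mulL (a : X → ℝ) : Lp ℝ 2 μ →L[ℝ] Lp ℝ 2 μ :=
  if ha : MemLp a ∞ μ then (ContinuousLinearMap.mul ℝ ℝ).holderL μ ∞ 2 2 (ha.toLp a) else 0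

theorem mulL_of_not_memLp (ha : ¬MemLp a ∞ μ) (g : Lp ℝ 2 μ) : mulL a g = 0 := by
  rw [mulL, dif_neg ha, zero_apply]

theorem coeFn_mulL (ha : MemLp a ∞ μ) (g : Lp ℝ 2 μ) :
    (mulL a g : X → ℝ) =ᵐ[μ] fun x => a x * g x := by
  rw [mulL, dif_pos ha]
  filter_upwards [(ContinuousLinearMap.mul ℝ ℝ).coeFn_holder (r := 2) (ha.toLp a) g,
    ha.coeFn_toLp] with x hx hax
  rw [← hax]
  exact hx

theorem norm_mulL_apply_le (hM : 0 ≤ M) (hb : ∀ x, |a x| ≤ M) (g : Lp ℝ 2 μ) :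
    ‖mulL a g‖ ≤ M * ‖g‖ := by
  by_cases ha : MemLp a ∞ μ
  · refine Lp.norm_le_mul_norm_of_ae_le_mul ?_
    filter_upwards [coeFn_mulL ha g] with x hx
    rw [hx, norm_mul]
    exact mul_le_mul_of_nonneg_right (hb x) (norm_nonneg _)
  · rw [mulL_of_not_memLp ha, norm_zero]
    positivity

theorem mulL_comm (a b : X → ℝ) (g : Lp ℝ 2 μ) : mulL a (mulL b g) = mulL b (mulL a g) := by
  by_cases ha : MemLp a ∞ μ
  · by_cases hb : MemLp b ∞ μ
    · refine Lp.ext ?_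
      filter_upwards [coeFn_mulL ha (mulL b g), coeFn_mulL hb (mulL a g), coeFn_mulL ha g,
        coeFn_mulL hb g] with x h1 h2 h3 h4
      rw [h1, h2, h3, h4, mul_left_comm]
    · simp only [mulL_of_not_memLp hb, map_zero]
  · simp only [mulL_of_not_memLp ha, map_zero]

/-- The bilinear form `∫ f g a` on `L²`. -/
def weightedForm (a : X → ℝ) : Lp ℝ 2 μ →L[ℝ] Lp ℝ 2 μ →L[ℝ] ℝ := innerSL ℝ ∘L mulL a

theorem weightedForm_eq_inner (f g : Lp ℝ 2 μ) :
    weightedForm a f g = inner ℝ (mulL a f) g := rfl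

theorem weightedForm_apply (ha : MemLp a ∞ μ) (f g : Lp ℝ 2 μ) :
    weightedForm a f g = ∫ x, f x * g x * a x ∂μ := by
  rw [weightedForm_eq_inner, L2.inner_def]
  refine integral_congr_ae ?_
  filter_upwards [coeFn_mulL ha f] with x hx
  rw [hx, RCLike.inner_apply, conj_trivial]
  ring

theorem weightedForm_comm (f g : Lp ℝ 2 μ) : weightedForm a f g = weightedForm a g f := by
  by_cases ha : MemLp a ∞ μ
  · simp only [weightedForm_apply ha, mul_comm (f _)]
  · simp [weightedForm, mulL_of_not_memLp ha]

theorem weightedForm_mulL (b : X → ℝ) (f g : Lp ℝ 2 μ) :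
    weightedForm a f (mulL b g) = weightedForm a (mulL b f) g := by
  rw [weightedForm_eq_inner, real_inner_comm, ← weightedForm_eq_inner, weightedForm_comm,
    weightedForm_eq_inner, mulL_comm, weightedForm_eq_inner]

theorem norm_weightedForm_apply_le (hM : 0 ≤ M) (hb : ∀ x, |a x| ≤ M) (g : Lp ℝ 2 μ) :
    ‖weightedForm a g‖ ≤ M * ‖g‖ :=
  (innerSL_apply_norm ℝ (mulL a g)).trans_le (norm_mulL_apply_le hM hb g)

theorem norm_sq_eq_integral (f : Lp ℝ 2 μ) : ‖f‖ ^ 2 = ∫ x, f x ^ 2 ∂μ := by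
  rw [← real_inner_self_eq_norm_sq, L2.inner_def]
  simp [pow_two]

theorem le_weightedForm_self (ha : MemLp a ∞ μ) {c : ℝ} (hc : ∀ x, c ≤ a x) (f : Lp ℝ 2 μ) :
    c * ‖f‖ ^ 2 ≤ weightedForm a f f := by
  have hint : Integrable (fun x => f x * f x * a x) μ := by
    refine (L2.integrable_inner (𝕜 := ℝ) (mulL a f) f).congr ?_
    filter_upwards [coeFn_mulL ha f] with x hx
    rw [hx, RCLike.inner_apply, conj_trivial]
    ring
  rw [weightedForm_apply ha, norm_sq_eq_integral, ← integral_const_mul]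
  refine integral_mono (((Lp.memLp f).integrable_sq).const_mul c) hint fun x => ?_
  rw [← pow_two, mul_comm]
  exact mul_le_mul_of_nonneg_left (hc x) (sq_nonneg _)

/-- Truncation of an `L²` function to the set `S`. -/
def cutoff (S : Set X) : Lp ℝ 2 μ →L[ℝ] Lp ℝ 2 μ := mulL (S.indicator 1)

theorem coeFn_cutoff (hS : MeasurableSet S) (g : Lp ℝ 2 μ) :
    (cutoff S g : X → ℝ) =ᵐ[μ] S.indicator g := by
  have h1 : MemLp (S.indicator (1 : X → ℝ)) ∞ μ := (memLp_top_const (1 : ℝ)).indicator hS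
  filter_upwards [coeFn_mulL h1 g] with x hx
  rw [cutoff, hx]
  by_cases h : x ∈ S <;> simp [h]

theorem norm_sq_cutoff (hS : MeasurableSet S) (g : Lp ℝ 2 μ) :
    ‖cutoff S g‖ ^ 2 = ∫ x in S, g x ^ 2 ∂μ := by
  rw [norm_sq_eq_integral, ← integral_indicator hS]
  refine integral_congr_ae ?_
  filter_upwards [coeFn_cutoff hS g] with x hx
  rw [hx]
  by_cases h : x ∈ S <;> simp [h]

theorem tendsto_cutoff {S : ℕ → Set X} (hS : ∀ n, MeasurableSet (S n)) {g : Lp ℝ 2 μ}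
    (hg : ∀ᵐ x ∂μ, g x ≠ 0 → ∀ᶠ n in atTop, x ∈ S n) :
    Tendsto (fun n => cutoff (S n) g) atTop (𝓝 g) := by
  have hnorm : ∀ n, ‖cutoff (S n) g - g‖ ^ 2 = ∫ x, (S n)ᶜ.indicator (fun x => g x ^ 2) x ∂μ := by
    intro n
    rw [norm_sq_eq_integral]
    refine integral_congr_ae ?_
    filter_upwards [Lp.coeFn_sub (cutoff (S n) g) g, coeFn_cutoff (hS n) g] with x h1 h2
    rw [h1, Pi.sub_apply, h2]
    by_cases h : x ∈ S n <;> simp [h]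
  have hint := (Lp.memLp g).integrable_sq
  have hlim : Tendsto (fun n => ‖cutoff (S n) g - g‖ ^ 2) atTop (𝓝 (∫ _, (0 : ℝ) ∂μ)) := by
    simp only [hnorm]
    refine tendsto_integral_of_dominated_convergence (fun x => g x ^ 2)
      (fun n => (hint.indicator (hS n).compl).aestronglyMeasurable) hint
      (fun n => Eventually.of_forall fun x => ?_) ?_
    · rw [Real.norm_of_nonneg (Set.indicator_nonneg (fun x _ => sq_nonneg _) x)]
      exact Set.indicator_le_self' (fun x _ => sq_nonneg _) x
    · filter_upwards [hg] with x hx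
      refine tendsto_const_nhds.congr' ?_
      by_cases h0 : g x = 0
      · exact Eventually.of_forall fun n =>
          (Set.indicator_apply_eq_zero.2 fun _ => by simp [h0]).symm
      · filter_upwards [hx h0] with n hn
        simp [hn]
  rw [integral_zero] at hlim
  rw [tendsto_iff_norm_sub_tendsto_zero]
  simpa using hlim.sqrt

variable {E : Type*} [NormedAddCommGroup E] [NormedSpace ℝ E]

theorem tendsto_weightedForm_comp {ι : Type*} {l : Filter ι} {a : ι → X → ℝ} {a₀ : X → ℝ}
    (hM : 0 ≤ M) (ha : ∀ i x, |a i x| ≤ M) (ha₀ : ∀ x, |a₀ x| ≤ M) {g : Lp ℝ 2 μ}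
    (hlim : ∀ h, Tendsto (fun i => weightedForm (a i) g h) l (𝓝 (weightedForm a₀ g h)))
    {A : E →L[ℝ] Lp ℝ 2 μ} {S : ℕ → Set X} (hS : Tendsto (fun n => cutoff (S n) g) atTop (𝓝 g))
    (hSA : ∀ n, IsCompactOperator (cutoff (S n) ∘L A)) :
    Tendsto (fun i => weightedForm (a i) g ∘L A) l (𝓝 (weightedForm a₀ g ∘L A)) := by
  have hcut : ∀ b : X → ℝ, (∀ x, |b x| ≤ M) → ∀ n : ℕ,
      ‖weightedForm b g ∘L (A - cutoff (S n) ∘L A)‖ ≤ M * ‖g - cutoff (S n) g‖ * ‖A‖ := by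
    intro b hb n
    have e : weightedForm b g ∘L (A - cutoff (S n) ∘L A) =
        weightedForm b (g - cutoff (S n) g) ∘L A := by
      ext v
      simp [cutoff, weightedForm_mulL]
    rw [e]
    refine (ContinuousLinearMap.opNorm_comp_le _ _).trans ?_
    gcongr
    exact norm_weightedForm_apply_le hM hb _
  have hsmall : Tendsto (fun n => M * ‖g - cutoff (S n) g‖ * ‖A‖) atTop (𝓝 0) := by
    simpa using (((hS.const_sub g).norm).const_mul M).mul_const ‖A‖
  refine tendsto_comp_of_approx (fun i => norm_weightedForm_apply_le hM (ha i) g) hlim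
    fun η hη => ?_
  obtain ⟨n, hn⟩ := (hsmall.eventually_le_const hη).exists
  exact ⟨cutoff (S n) ∘L A, hSA n, fun i => (hcut _ (ha i) n).trans hn, (hcut _ ha₀ n).trans hn⟩

end Multiplication

section Sobolev

variable {d : ℕ} {s : ℝ}

theorem isClosed_fracSobolev (d : ℕ) (s : ℝ) :
    IsClosed (fracSobolev d s : Set (WithLp 2 (L2 d × L2Pair d))) := by
  refine IsSeqClosed.isClosed fun w w₀ hw hlim => ?_
  have h1 : Tendsto (fun n => (w n).fst) atTop (𝓝 w₀.fst) :=
    ((WithLp.fstL 2 ℝ (L2 d) (L2Pair d)).continuous.tendsto w₀).comp hlim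
  have h2 : Tendsto (fun n => (w n).snd) atTop (𝓝 w₀.snd) :=
    ((WithLp.sndL 2 ℝ (L2 d) (L2Pair d)).continuous.tendsto w₀).comp hlim
  obtain ⟨φ, hφ, hφae⟩ := (tendstoInMeasure_of_tendsto_Lp h1).exists_seq_tendsto_ae
  obtain ⟨ψ, hψ, hψae⟩ := (tendstoInMeasure_of_tendsto_Lp
    (h2.comp hφ.tendsto_atTop)).exists_seq_tendsto_ae
  have hφ₁ := (Measure.quasiMeasurePreserving_fst
    (μ := (volume : Measure (Euc d))) (ν := (volume : Measure (Euc d)))).ae hφae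
  have hφ₂ := (Measure.quasiMeasurePreserving_snd
    (μ := (volume : Measure (Euc d))) (ν := (volume : Measure (Euc d)))).ae hφae
  have hw' : ∀ᵐ p : Euc d × Euc d, ∀ n, (w n).snd p = fracDiff s ((w n).fst : Euc d → ℝ) p :=
    ae_all_iff.2 fun n => hw n
  change (w₀.snd : Euc d × Euc d → ℝ) =ᵐ[volume] fracDiff s (w₀.fst : Euc d → ℝ)
  filter_upwards [hψae, hφ₁, hφ₂, hw'] with p hp hp1 hp2 hpw
  refine tendsto_nhds_unique hp ?_
  simp only [Function.comp_apply, hpw]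
  exact ((hp2.comp hψ.tendsto_atTop).sub (hp1.comp hψ.tendsto_atTop)).div_const _

instance completeSpace_fracSobolev : CompleteSpace (fracSobolev d s) :=
  (isClosed_fracSobolev d s).completeSpace_coe

/-- The inclusion `toL2` of `H^s(ℝ^d)` in `L²(ℝ^d)`, as a continuous linear map. -/
def toL2CLM : fracSobolev d s →L[ℝ] L2 d :=
  WithLp.fstL 2 ℝ (L2 d) (L2Pair d) ∘L (fracSobolev d s).subtypeL

/-- The fractional difference quotient `D u`, as a continuous linear map
`H^s(ℝ^d) → L²(ℝ^d × ℝ^d)`. -/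
def diffQuot : fracSobolev d s →L[ℝ] L2Pair d :=
  WithLp.sndL 2 ℝ (L2 d) (L2Pair d) ∘L (fracSobolev d s).subtypeL

theorem coeFn_diffQuot (u : fracSobolev d s) :
    (diffQuot u : Euc d × Euc d → ℝ) =ᵐ[volume] fracDiff s (toL2CLM u) := u.2

theorem norm_sq_eq_add (u : fracSobolev d s) : ‖u‖ ^ 2 = ‖toL2CLM u‖ ^ 2 + ‖diffQuot u‖ ^ 2 :=
  WithLp.prod_norm_sq_eq_of_L2 _

theorem norm_diffQuot_le (u : fracSobolev d s) : ‖diffQuot u‖ ≤ ‖u‖ := by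
  refine le_of_sq_le_sq ?_ (norm_nonneg _)
  rw [norm_sq_eq_add]
  linarith [sq_nonneg ‖toL2CLM u‖]

theorem sq_sub_eq_fracDiff (s : ℝ) (g : Euc d → ℝ) (x y : Euc d) :
    (g y - g x) ^ 2 = ‖x - y‖ ^ ((d : ℝ) + 2 * s) * fracDiff s g (x, y) ^ 2 := by
  by_cases h : x = y
  · simp [h, fracDiff]
  · have h' : 0 < ‖x - y‖ := norm_pos_iff.2 (sub_ne_zero.2 h)
    have hp : ‖x - y‖ ^ ((d : ℝ) + 2 * s) = (‖x - y‖ ^ ((d : ℝ) / 2 + s)) ^ 2 := by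
      rw [← Real.rpow_mul_natCast (norm_nonneg _)]
      congr 1
      push_cast
      ring
    rw [hp, fracDiff, div_pow]
    exact (mul_div_cancel₀ _ (pow_ne_zero 2 (Real.rpow_pos_of_pos h' _).ne')).symm

end Sobolev

section Rellich

variable {d : ℕ} {s δ R : ℝ}

theorem sq_le_sq_setAverage_add {X : Type*} [MeasurableSpace X] {μ : Measure X} {Q : Set X}
    (hQ0 : μ Q ≠ 0) (hQ : μ Q ≠ ⊤) {g : X → ℝ} (hg : MemLp g 2 (μ.restrict Q)) (a : ℝ) :
    a ^ 2 ≤ 2 * (⨍ y in Q, g y ∂μ) ^ 2 + 2 * ⨍ y in Q, (g y - a) ^ 2 ∂μ := by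
  have : IsFiniteMeasure (μ.restrict Q) := ⟨by simpa using hQ.lt_top⟩
  have hga : MemLp (fun y => g y - a) 2 (μ.restrict Q) := hg.sub (memLp_const a)
  have jensen : (⨍ y in Q, (g y - a) ∂μ) ^ 2 ≤ ⨍ y in Q, (g y - a) ^ 2 ∂μ :=
    (even_two.convexOn_pow (𝕜 := ℝ)).map_set_average_le (continuousOn_pow 2) isClosed_univ hQ0 hQ
      (Eventually.of_forall fun _ => Set.mem_univ _) (hga.integrable one_le_two) hga.integrable_sq
  have mean : ⨍ y in Q, (g y - a) ∂μ = (⨍ y in Q, g y ∂μ) - a := by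
    have hreal : μ.real Q ≠ 0 := (measureReal_ne_zero_iff hQ).2 hQ0
    rw [setAverage_eq, setAverage_eq,
      integral_sub (hg.integrable one_le_two) (integrable_const a), setIntegral_const]
    simp only [smul_eq_mul]
    field_simp
  rw [mean] at jensen
  nlinarith [sq_nonneg (2 * (⨍ y in Q, g y ∂μ) - a)]

/-- A finite set containing the indices of all grid cells of step `δ` that meet the ball of
radius `R`. -/
def cellIndices (d : ℕ) (δ R : ℝ) : Finset (Fin d → ℤ) :=
  Finset.Icc (fun _ => ⌊-R / δ⌋) (fun _ => ⌊R / δ⌋)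

theorem cellIndex_mem_cellIndices (hδ : 0 < δ) {x : Euc d} (hx : ‖x‖ ≤ R) :
    cellIndex δ x ∈ cellIndices d δ R := by
  have h : ∀ i, -R ≤ x i ∧ x i ≤ R := fun i => by
    have := (PiLp.norm_apply_le x i).trans hx
    rwa [Real.norm_eq_abs, abs_le] at this
  rw [cellIndices, Finset.mem_Icc]
  exact ⟨fun i => Int.floor_mono (div_le_div_of_nonneg_right (h i).1 hδ.le),
    fun i => Int.floor_mono (div_le_div_of_nonneg_right (h i).2 hδ.le)⟩

/-- The integrals of a function in `L²` over the grid cells with index in `cellIndices d δ R`: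
a map of finite rank. -/
def cellIntegrals (hδ : 0 ≤ δ) (R : ℝ) : L2 d →L[ℝ] (cellIndices d δ R → ℝ) :=
  ContinuousLinearMap.pi fun k => innerSL ℝ
    (indicatorConstLp 2 (measurableSet_gridCell δ k)
      (by rw [volume_gridCell hδ]; exact ENNReal.ofReal_ne_top) (1 : ℝ))

theorem cellIntegrals_apply (hδ : 0 ≤ δ) (w : L2 d) (k : cellIndices d δ R) :
    cellIntegrals hδ R w k = ∫ y in gridCell δ k, w y :=
  L2.inner_indicatorConstLp_one _ _ _

/-- The constant of the fractional Poincaré inequality on a grid cell of step `δ`. -/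
def poincareConst (d : ℕ) (s δ : ℝ) : ℝ := (δ ^ d)⁻¹ * (d * δ) ^ ((d : ℝ) + 2 * s)

theorem poincareConst_nonneg (hδ : 0 ≤ δ) : 0 ≤ poincareConst d s δ := by
  unfold poincareConst
  positivity

theorem tendsto_poincareConst (d : ℕ) (hs : 0 < s) :
    Tendsto (poincareConst d s) (𝓝[>] 0) (𝓝 0) := by
  have h : Tendsto (fun δ : ℝ => (d : ℝ) ^ ((d : ℝ) + 2 * s) * δ ^ (2 * s)) (𝓝[>] 0) (𝓝 0) := by
    have h1 : Tendsto (fun δ : ℝ => δ ^ (2 * s)) (𝓝 0) (𝓝 (0 ^ (2 * s))) :=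
      (Real.continuousAt_rpow_const 0 (2 * s) (Or.inr (by positivity))).tendsto
    rw [Real.zero_rpow (by positivity)] at h1
    simpa using (h1.mono_left nhdsWithin_le_nhds).const_mul ((d : ℝ) ^ ((d : ℝ) + 2 * s))
  refine h.congr' ?_
  filter_upwards [self_mem_nhdsWithin] with δ (hδ : 0 < δ)
  rw [poincareConst, Real.mul_rpow (Nat.cast_nonneg d) hδ.le, Real.rpow_add hδ, Real.rpow_natCast]
  field_simp

theorem setAverage_sq_sub_le (hs : 0 ≤ s) (hδ : 0 < δ) {k : Fin d → ℤ} {g : Euc d → ℝ} {x : Euc d}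
    (hx : x ∈ gridCell δ k) (hg : MemLp g 2)
    (hD : Integrable fun y => fracDiff s g (x, y) ^ 2) :
    ⨍ y in gridCell δ k, (g y - g x) ^ 2 ≤
      poincareConst d s δ * ∫ y, fracDiff s g (x, y) ^ 2 := by
  have hvol := volume_gridCell hδ.le k
  have : IsFiniteMeasure (volume.restrict (gridCell δ k)) := ⟨by simp [hvol]⟩
  have hreal : volume.real (gridCell δ k) = δ ^ d := by
    rw [measureReal_def, hvol, ENNReal.toReal_ofReal (by positivity)]
  rw [setAverage_eq, hreal, smul_eq_mul, poincareConst, mul_assoc]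
  refine mul_le_mul_of_nonneg_left ?_ (by positivity)
  calc ∫ y in gridCell δ k, (g y - g x) ^ 2
      ≤ ∫ y in gridCell δ k, (d * δ) ^ ((d : ℝ) + 2 * s) * fracDiff s g (x, y) ^ 2 := by
        refine setIntegral_mono_on ((hg.restrict _).sub (memLp_const _)).integrable_sq
          (hD.integrableOn.const_mul _) (measurableSet_gridCell δ k) fun y hy => ?_
        rw [sq_sub_eq_fracDiff s]
        gcongr
        exact norm_sub_le_of_mem_gridCell hx hy
    _ = (d * δ) ^ ((d : ℝ) + 2 * s) * ∫ y in gridCell δ k, fracDiff s g (x, y) ^ 2 :=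
        integral_const_mul _ _
    _ ≤ (d * δ) ^ ((d : ℝ) + 2 * s) * ∫ y, fracDiff s g (x, y) ^ 2 :=
        mul_le_mul_of_nonneg_left (setIntegral_le_integral hD
          (Eventually.of_forall fun y => sq_nonneg _)) (by positivity)

theorem ae_sq_le_cellIntegrals_add (hs : 0 ≤ s) (hδ : 0 < δ) (v : fracSobolev d s) :
    ∀ᵐ x : Euc d, ‖x‖ ≤ R → toL2CLM v x ^ 2 ≤
      2 * ((δ ^ d)⁻¹ * ‖cellIntegrals hδ.le R (toL2CLM v)‖) ^ 2 +
        2 * (poincareConst d s δ * ∫ y, diffQuot v (x, y) ^ 2) := by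
  have hD : Integrable (fun p : Euc d × Euc d => diffQuot v p ^ 2) (volume.prod volume) :=
    (Lp.memLp (diffQuot v)).integrable_sq
  filter_upwards [Measure.ae_ae_of_ae_prod (coeFn_diffQuot v), hD.prod_right_ae]
    with x hx hDx hxR
  have hx2 : (fun y => diffQuot v (x, y) ^ 2) =ᵐ[volume]
      fun y => fracDiff s (toL2CLM v) (x, y) ^ 2 := hx.mono fun y hy => by simp only [hy]
  have hvol := volume_gridCell hδ.le (cellIndex δ x)
  have hreal : volume.real (gridCell δ (cellIndex δ x)) = δ ^ d := by
    rw [measureReal_def, hvol, ENNReal.toReal_ofReal (by positivity)]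
  have hmean : |∫ y in gridCell δ (cellIndex δ x), toL2CLM v y| ≤
      ‖cellIntegrals hδ.le R (toL2CLM v)‖ := by
    have h := norm_le_pi_norm (cellIntegrals hδ.le R (toL2CLM v))
      ⟨cellIndex δ x, cellIndex_mem_cellIndices hδ hxR⟩
    rwa [cellIntegrals_apply] at h
  refine (sq_le_sq_setAverage_add (μ := volume) (Q := gridCell δ (cellIndex δ x))
    (by simpa [hvol] using pow_pos hδ d) (by simp [hvol]) ((Lp.memLp (toL2CLM v)).restrict _)
    (toL2CLM v x)).trans ?_
  gcongr ?_ + 2 * ?_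
  · rw [setAverage_eq, hreal, smul_eq_mul, mul_pow, mul_pow, ← sq_abs (∫ y in _, _)]
    gcongr
  · rw [integral_congr_ae hx2]
    exact setAverage_sq_sub_le hs hδ ((mem_gridCell_iff hδ).2 rfl) (Lp.memLp _)
      (hDx.congr hx2)

theorem norm_sq_cutoff_closedBall_le (hs : 0 ≤ s) (hδ : 0 < δ) (v : fracSobolev d s) :
    ‖cutoff (Metric.closedBall 0 R) (toL2CLM v)‖ ^ 2 ≤
      volume.real (Metric.closedBall (0 : Euc d) R) *
        (2 * ((δ ^ d)⁻¹ * ‖cellIntegrals hδ.le R (toL2CLM v)‖) ^ 2) +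
      2 * poincareConst d s δ * ‖diffQuot v‖ ^ 2 := by
  have hD : Integrable (fun p : Euc d × Euc d => diffQuot v p ^ 2) (volume.prod volume) :=
    (Lp.memLp (diffQuot v)).integrable_sq
  have hBm : MeasurableSet (Metric.closedBall (0 : Euc d) R) := measurableSet_closedBall
  have : IsFiniteMeasure ((volume : Measure (Euc d)).restrict (Metric.closedBall 0 R)) :=
    ⟨by simpa using measure_closedBall_lt_top⟩
  have hDx : Integrable fun x : Euc d => 2 * (poincareConst d s δ * ∫ y, diffQuot v (x, y) ^ 2) :=
    (hD.integral_prod_left.const_mul _).const_mul 2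
  rw [norm_sq_cutoff hBm]
  refine (setIntegral_mono_on_ae (Lp.memLp _).integrable_sq.integrableOn
    ((integrable_const _).add hDx.integrableOn) hBm
    ((ae_sq_le_cellIntegrals_add hs hδ v).mono fun x hx hxB => hx (by simpa using hxB))).trans ?_
  rw [integral_add' (integrable_const _) hDx.integrableOn, setIntegral_const, smul_eq_mul]
  gcongr
  refine (setIntegral_le_integral hDx (Eventually.of_forall fun x => ?_)).trans_eq ?_
  · have := poincareConst_nonneg (d := d) (s := s) hδ.le
    positivity
  · rw [integral_const_mul, integral_const_mul, mul_assoc, norm_sq_eq_integral]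
    exact congrArg _ (congrArg _ (integral_prod _ hD).symm)

theorem isCompactOperator_cutoff_toL2CLM (hs : 0 < s) (R : ℝ) :
    IsCompactOperator
      (cutoff (Metric.closedBall 0 R) ∘L (toL2CLM : fracSobolev d s →L[ℝ] L2 d)) := by
  refine isCompactOperator_of_norm_le fun η hη => ?_
  have hconst : ∀ᶠ δ in 𝓝[>] (0 : ℝ), 2 * poincareConst d s δ ≤ η ^ 2 := by
    have h := (tendsto_poincareConst d hs).const_mul 2
    rw [mul_zero] at h
    exact h.eventually_le_const (by positivity)
  obtain ⟨δ, hδη, hδ : 0 < δ⟩ := (hconst.and self_mem_nhdsWithin).exists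
  set V := volume.real (Metric.closedBall (0 : Euc d) R)
  refine ⟨cellIndices d δ R → ℝ, inferInstance, inferInstance, cellIntegrals hδ.le R ∘L toL2CLM,
    √(2 * V) * (δ ^ d)⁻¹, isCompactOperator_of_locallyCompactSpace_dom _, fun v => ?_⟩
  set N := ‖cellIntegrals hδ.le R (toL2CLM v)‖
  have hN : 0 ≤ √(2 * V) * (δ ^ d)⁻¹ * N := by positivity
  refine le_of_sq_le_sq ?_ (by positivity)
  calc ‖cutoff (Metric.closedBall 0 R) (toL2CLM v)‖ ^ 2
      ≤ V * (2 * ((δ ^ d)⁻¹ * N) ^ 2) + 2 * poincareConst d s δ * ‖diffQuot v‖ ^ 2 :=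
        norm_sq_cutoff_closedBall_le hs.le hδ v
    _ ≤ V * (2 * ((δ ^ d)⁻¹ * N) ^ 2) + η ^ 2 * ‖v‖ ^ 2 := by
        gcongr
        exact norm_diffQuot_le v
    _ = (√(2 * V) * (δ ^ d)⁻¹ * N) ^ 2 + (η * ‖v‖) ^ 2 := by
        rw [mul_pow, mul_pow, mul_pow, mul_pow, Real.sq_sqrt (by positivity)]
        ring
    _ ≤ (η * ‖v‖ + √(2 * V) * (δ ^ d)⁻¹ * N) ^ 2 := by
        have : 0 ≤ η * ‖v‖ := by positivity
        nlinarith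

end Rellich

section SeparatedPairs

variable {d : ℕ} {s R ρ : ℝ}

/-- The pairs of points in the ball of radius `R` at distance at least `ρ`. -/
def separatedPairs (d : ℕ) (R ρ : ℝ) : Set (Euc d × Euc d) :=
  {p | ‖p.1‖ ≤ R ∧ ‖p.2‖ ≤ R ∧ ρ ≤ ‖p.1 - p.2‖}

theorem measurableSet_separatedPairs (R ρ : ℝ) : MeasurableSet (separatedPairs d R ρ) :=
  (measurableSet_le measurable_fst.norm measurable_const).inter
    ((measurableSet_le measurable_snd.norm measurable_const).inter
      (measurableSet_le measurable_const (measurable_fst.sub measurable_snd).norm))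

theorem separatedPairs_subset_prod (R ρ : ℝ) :
    separatedPairs d R ρ ⊆ Metric.closedBall 0 R ×ˢ Metric.closedBall 0 R :=
  fun p hp => ⟨by simpa using hp.1, by simpa using hp.2.1⟩

theorem eventually_mem_separatedPairs {p : Euc d × Euc d} (hp : p.1 ≠ p.2) :
    ∀ᶠ n : ℕ in atTop, p ∈ separatedPairs d n (1 / (n + 1)) := by
  have hdist : 0 < ‖p.1 - p.2‖ := norm_pos_iff.2 (sub_ne_zero.2 hp)
  filter_upwards [tendsto_natCast_atTop_atTop.eventually_ge_atTop ‖p.1‖,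
    tendsto_natCast_atTop_atTop.eventually_ge_atTop ‖p.2‖,
    tendsto_one_div_add_atTop_nhds_zero_nat.eventually_le_const hdist] with n h1 h2 h3
  exact ⟨h1, h2, h3⟩

theorem tendsto_cutoff_separatedPairs (u : fracSobolev d s) :
    Tendsto (fun n : ℕ => cutoff (separatedPairs d n (1 / (n + 1))) (diffQuot u)) atTop
      (𝓝 (diffQuot u)) := by
  refine tendsto_cutoff (fun n => measurableSet_separatedPairs _ _) ?_
  filter_upwards [coeFn_diffQuot u] with p hp hne
  refine eventually_mem_separatedPairs fun h => hne ?_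
  rw [hp, fracDiff, h, sub_self, zero_div]

theorem tendsto_cutoff_closedBall (g : L2 d) :
    Tendsto (fun n : ℕ => cutoff (Metric.closedBall 0 (n : ℝ)) g) atTop (𝓝 g) := by
  refine tendsto_cutoff (fun n => measurableSet_closedBall) (Eventually.of_forall fun x _ => ?_)
  filter_upwards [tendsto_natCast_atTop_atTop.eventually_ge_atTop ‖x‖] with n hn
  simpa using hn

theorem sq_fracDiff_le_of_mem_separatedPairs (hs : 0 ≤ s) (hρ : 0 < ρ) (g : Euc d → ℝ)
    {p : Euc d × Euc d} (hp : p ∈ separatedPairs d R ρ) :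
    fracDiff s g p ^ 2 ≤ 2 * (ρ ^ ((d : ℝ) / 2 + s))⁻¹ ^ 2 * (g p.1 ^ 2 + g p.2 ^ 2) := by
  have hinv : (‖p.1 - p.2‖ ^ ((d : ℝ) / 2 + s))⁻¹ ≤ (ρ ^ ((d : ℝ) / 2 + s))⁻¹ :=
    inv_anti₀ (by positivity) (Real.rpow_le_rpow hρ.le hp.2.2 (by positivity))
  calc fracDiff s g p ^ 2
      = (g p.2 - g p.1) ^ 2 * (‖p.1 - p.2‖ ^ ((d : ℝ) / 2 + s))⁻¹ ^ 2 := by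
        rw [fracDiff, div_eq_mul_inv, mul_pow]
    _ ≤ (2 * (g p.1 ^ 2 + g p.2 ^ 2)) * (ρ ^ ((d : ℝ) / 2 + s))⁻¹ ^ 2 := by
        gcongr
        nlinarith [sq_nonneg (g p.2 + g p.1)]
    _ = _ := by ring

theorem norm_sq_cutoff_separatedPairs_le (hs : 0 ≤ s) (hρ : 0 < ρ) (v : fracSobolev d s) :
    ‖cutoff (separatedPairs d R ρ) (diffQuot v)‖ ^ 2 ≤
      4 * (ρ ^ ((d : ℝ) / 2 + s))⁻¹ ^ 2 * volume.real (Metric.closedBall (0 : Euc d) R) *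
        ‖cutoff (Metric.closedBall 0 R) (toL2CLM v)‖ ^ 2 := by
  set B := Metric.closedBall (0 : Euc d) R
  set c := (ρ ^ ((d : ℝ) / 2 + s))⁻¹
  have : IsFiniteMeasure ((volume : Measure (Euc d)).restrict B) :=
    ⟨by simpa using measure_closedBall_lt_top⟩
  have hv : Integrable (fun x => toL2CLM v x ^ 2) (volume.restrict B) :=
    (Lp.memLp (toL2CLM v)).integrable_sq.restrict
  have hprod : (volume : Measure (Euc d × Euc d)).restrict (B ×ˢ B) =
      (volume.restrict B).prod (volume.restrict B) := (Measure.prod_restrict B B).symm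
  have hsum : Integrable (fun p : Euc d × Euc d =>
      2 * c ^ 2 * (toL2CLM v p.1 ^ 2 + toL2CLM v p.2 ^ 2)) (volume.restrict (B ×ˢ B)) := by
    rw [hprod]
    exact ((hv.comp_fst _).add (hv.comp_snd _)).const_mul _
  rw [norm_sq_cutoff (measurableSet_separatedPairs R ρ), norm_sq_cutoff measurableSet_closedBall]
  calc ∫ p in separatedPairs d R ρ, diffQuot v p ^ 2
      ≤ ∫ p in separatedPairs d R ρ, 2 * c ^ 2 * (toL2CLM v p.1 ^ 2 + toL2CLM v p.2 ^ 2) := by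
        refine setIntegral_mono_on_ae (Lp.memLp _).integrable_sq.integrableOn
          (hsum.mono_measure (Measure.restrict_mono (separatedPairs_subset_prod R ρ) le_rfl))
          (measurableSet_separatedPairs R ρ) ?_
        filter_upwards [coeFn_diffQuot v] with p hp hpS
        rw [hp]
        exact sq_fracDiff_le_of_mem_separatedPairs hs hρ _ hpS
    _ ≤ ∫ p in B ×ˢ B, 2 * c ^ 2 * (toL2CLM v p.1 ^ 2 + toL2CLM v p.2 ^ 2) :=
        setIntegral_mono_set hsum (Eventually.of_forall fun p => by positivity)
          (separatedPairs_subset_prod R ρ).eventuallyLE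
    _ = 4 * c ^ 2 * volume.real B * ∫ x in B, toL2CLM v x ^ 2 := by
        rw [integral_const_mul, hprod, integral_add (hv.comp_fst _) (hv.comp_snd _),
          integral_fun_fst (fun x => toL2CLM v x ^ 2), integral_fun_snd (fun x => toL2CLM v x ^ 2)]
        simp only [measureReal_restrict_apply_univ, smul_eq_mul]
        ring

theorem isCompactOperator_cutoff_diffQuot (hs : 0 < s) (hρ : 0 < ρ) (R : ℝ) :
    IsCompactOperator
      (cutoff (separatedPairs d R ρ) ∘L (diffQuot : fracSobolev d s →L[ℝ] L2Pair d)) := by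
  refine isCompactOperator_of_norm_le fun η hη => ?_
  set K := 4 * (ρ ^ ((d : ℝ) / 2 + s))⁻¹ ^ 2 * volume.real (Metric.closedBall (0 : Euc d) R)
  refine ⟨L2 d, inferInstance, inferInstance, cutoff (Metric.closedBall 0 R) ∘L toL2CLM, √K,
    isCompactOperator_cutoff_toL2CLM hs R, fun v => ?_⟩
  have hbound : ‖cutoff (separatedPairs d R ρ) (diffQuot v)‖ ≤
      √K * ‖cutoff (Metric.closedBall 0 R) (toL2CLM v)‖ := by
    refine le_of_sq_le_sq ?_ (by positivity)
    rw [mul_pow, Real.sq_sqrt (by positivity)]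
    exact norm_sq_cutoff_separatedPairs_le hs.le hρ v
  exact le_add_of_nonneg_of_le (by positivity) hbound

end SeparatedPairs

section RescaledForms

open scoped ENNReal

variable {Z : Type*} [NormedAddCommGroup Z] [NormedSpace ℝ Z] [FiniteDimensional ℝ Z]
  [MeasurableSpace Z] [BorelSpace Z] {μ : Measure Z} [μ.IsAddHaarMeasure] {Γ Y : Set Z} {M : ℝ}
  {k : Z → Z → ℝ}

theorem IsLocallyPeriodic.memLp_rescaled (hk : IsLocallyPeriodic μ Γ M k) {ε : ℝ} (hε : ε ≠ 0) :
    MemLp (fun p => k p (ε⁻¹ • p)) ∞ μ :=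
  memLp_top_of_bound (hk.aemeasurable_rescaled hε).aestronglyMeasurable M
    (Eventually.of_forall fun p => hk.abs_le p _)

theorem IsLocallyPeriodic.memLp_average (hk : IsLocallyPeriodic μ Γ M k)
    (hY : IsAveragingCell μ Γ Y) : MemLp (fun p => ∫ q in Y, k p q ∂μ) ∞ μ :=
  memLp_top_of_bound (aestronglyMeasurable_setIntegral hk.continuous hk.aemeasurable Y μ) M
    (Eventually.of_forall fun p => hk.abs_average_le hY p)

theorem IsAveragingCell.tendsto_weightedForm_rescaled (hY : IsAveragingCell μ Γ Y)
    (hk : IsLocallyPeriodic μ Γ M k) (g h : Lp ℝ 2 μ) :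
    Tendsto (fun ε : ℝ => weightedForm (fun p => k p (ε⁻¹ • p)) g h) (𝓝[>] 0)
      (𝓝 (weightedForm (fun p => ∫ q in Y, k p q ∂μ) g h)) := by
  rw [weightedForm_apply (hk.memLp_average hY)]
  refine (hY.tendsto_integral_rescaled hk ((Lp.memLp g).integrable_mul (Lp.memLp h))).congr' ?_
  filter_upwards [self_mem_nhdsWithin] with ε (hε : 0 < ε)
  exact (weightedForm_apply (hk.memLp_rescaled hε.ne') g h).symm

end RescaledForms

section Resolvent

open scoped ENNReal

variable {d : ℕ} {s α m c : ℝ} {κ : Euc d × Euc d → ℝ} {w ν : Euc d → ℝ} {f : L2 d}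

/-- The form `½ ∫∫ κ Du Dv + m ∫ w u v` on `H^s(ℝ^d)`, where `D` is the fractional difference
quotient. For `κ(x,y) = Λ(x,y) ν(x)` and `w = ν` it is the form of `m - L` in `L²(ℝ^d, ν)`. -/
def resolventForm (κ : Euc d × Euc d → ℝ) (w : Euc d → ℝ) (m : ℝ) :
    fracSobolev d s →L[ℝ] fracSobolev d s →L[ℝ] ℝ :=
  (1 / 2 : ℝ) • (weightedForm κ).bilinearComp diffQuot diffQuot +
    m • (weightedForm w).bilinearComp toL2CLM toL2CLM

theorem resolventForm_apply (κ : Euc d × Euc d → ℝ) (w : Euc d → ℝ) (m : ℝ)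
    (u : fracSobolev d s) :
    resolventForm κ w m u = (1 / 2 : ℝ) • (weightedForm κ (diffQuot u) ∘L diffQuot) +
      m • (weightedForm w (toL2CLM u) ∘L toL2CLM) := rfl

theorem resolventForm_apply_apply (κ : Euc d × Euc d → ℝ) (w : Euc d → ℝ) (m : ℝ)
    (u v : fracSobolev d s) :
    resolventForm κ w m u v = 1 / 2 * weightedForm κ (diffQuot u) (diffQuot v) +
      m * weightedForm w (toL2CLM u) (toL2CLM v) := rfl

theorem le_resolventForm_self (hκ : MemLp κ ∞ volume) (hw : MemLp w ∞ volume) (hc : 0 ≤ c)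
    (hκc : ∀ p, c ≤ κ p) (hwc : ∀ x, c ≤ w x) (hm : 0 ≤ m) (u : fracSobolev d s) :
    c * min (1 / 2) m * ‖u‖ ^ 2 ≤ resolventForm κ w m u u := by
  calc c * min (1 / 2) m * ‖u‖ ^ 2
      = min (1 / 2) m * (c * ‖diffQuot u‖ ^ 2) + min (1 / 2) m * (c * ‖toL2CLM u‖ ^ 2) := by
        rw [norm_sq_eq_add]
        ring
    _ ≤ 1 / 2 * (c * ‖diffQuot u‖ ^ 2) + m * (c * ‖toL2CLM u‖ ^ 2) := by
        gcongr
        · exact min_le_left _ _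
        · exact min_le_right _ _
    _ ≤ resolventForm κ w m u u := by
        rw [resolventForm_apply_apply]
        gcongr
        · exact le_weightedForm_self hκ hκc _
        · exact le_weightedForm_self hw hwc _

theorem existsUnique_resolventForm_eq (hκ : MemLp κ ∞ volume) (hw : MemLp w ∞ volume) (hc : 0 < c)
    (hκc : ∀ p, c ≤ κ p) (hwc : ∀ x, c ≤ w x) (hm : 0 < m) (ℓ : fracSobolev d s →L[ℝ] ℝ) :
    ∃! u, resolventForm κ w m u = ℓ := by
  refine existsUnique_apply_eq_of_isCoercive ⟨c * min (1 / 2) m, by positivity, fun u => ?_⟩ ℓ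
  rw [mul_assoc, ← pow_two]
  exact le_resolventForm_self hκ hw hc.le hκc hwc hm.le u

theorem levyForm_eq_weightedForm {Λ : Euc d → Euc d → ℝ}
    (hκ : MemLp (fun p : Euc d × Euc d => Λ p.1 p.2 * ν p.1) ∞ volume)
    (u v : fracSobolev d (α / 2)) :
    levyForm α Λ ν (toL2 u) (toL2 v) =
      1 / 2 * weightedForm (fun p => Λ p.1 p.2 * ν p.1) (diffQuot u) (diffQuot v) := by
  rw [levyForm, weightedForm_apply hκ]
  congr 1
  refine integral_congr_ae ?_
  filter_upwards [coeFn_diffQuot u, coeFn_diffQuot v] with p hu hv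
  have hp : ‖p.1 - p.2‖ ^ ((d : ℝ) + α) =
      ‖p.1 - p.2‖ ^ ((d : ℝ) / 2 + α / 2) * ‖p.1 - p.2‖ ^ ((d : ℝ) / 2 + α / 2) := by
    rw [← pow_two, ← Real.rpow_mul_natCast (norm_nonneg _)]
    congr 1
    push_cast
    ring
  rw [hu, hv, fracDiff, fracDiff, hp, div_mul_div_comm]
  change _ = (toL2 u p.2 - toL2 u p.1) * (toL2 v p.2 - toL2 v p.1) / _ * _
  ring

theorem isResolventSolution_iff {Λ : Euc d → Euc d → ℝ}
    (hκ : MemLp (fun p : Euc d × Euc d => Λ p.1 p.2 * ν p.1) ∞ volume) (hν : MemLp ν ∞ volume)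
    {u : fracSobolev d (α / 2)} :
    IsResolventSolution α Λ ν m f u ↔
      resolventForm (fun p => Λ p.1 p.2 * ν p.1) ν m u = -(weightedForm ν f ∘L toL2CLM) := by
  have hrhs : ∀ v : fracSobolev d (α / 2), ∫ x, (f + m • toL2CLM u) x * toL2 v x * ν x =
      weightedForm ν f (toL2CLM v) + m * weightedForm ν (toL2CLM u) (toL2CLM v) := fun v => by
    have h := weightedForm_apply hν (f + m • toL2CLM u) (toL2CLM v)
    rw [map_add, map_smul] at h
    exact h.symm
  have hgraph : LevyOperatorGraph α Λ ν u (f + m • toL2CLM u) ↔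
      resolventForm (fun p => Λ p.1 p.2 * ν p.1) ν m u = -(weightedForm ν f ∘L toL2CLM) := by
    rw [ContinuousLinearMap.ext_iff]
    refine forall_congr' fun v => ?_
    rw [hrhs, levyForm_eq_weightedForm hκ, resolventForm_apply_apply, neg_apply,
      ContinuousLinearMap.comp_apply]
    constructor <;> intro h <;> linarith
  rw [← hgraph]
  constructor
  · rintro ⟨g, hg, rfl⟩
    rwa [show g - m • toL2 u + m • toL2CLM u = g from sub_add_cancel g _]
  · exact fun h => ⟨_, h, add_sub_cancel_right f _⟩

theorem isResolventSolution_const_mul_iff {Λ : Euc d → Euc d → ℝ} {u : fracSobolev d (α / 2)}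
    {t : ℝ} (ht : t ≠ 0) :
    IsResolventSolution α Λ (fun x => t * ν x) m f u ↔ IsResolventSolution α Λ ν m f u := by
  have hgraph : ∀ g,
      LevyOperatorGraph α Λ (fun x => t * ν x) u g ↔ LevyOperatorGraph α Λ ν u g := by
    refine fun g => forall_congr' fun v => ?_
    simp only [levyForm, mul_left_comm _ t, integral_const_mul, ← mul_neg]
    exact mul_right_inj' ht
  simp only [IsResolventSolution, hgraph]

end Resolvent

section StrongConvergence

variable {d : ℕ} {s m M : ℝ} {ι : Type*} {l : Filter ι}

theorem tendsto_weightedForm_comp_toL2CLM (hs : 0 < s) (hM : 0 ≤ M) {w : ι → Euc d → ℝ}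
    {w₀ : Euc d → ℝ} (hw : ∀ i x, |w i x| ≤ M) (hw₀ : ∀ x, |w₀ x| ≤ M)
    (hlim : ∀ g h : L2 d, Tendsto (fun i => weightedForm (w i) g h) l (𝓝 (weightedForm w₀ g h)))
    (g : L2 d) :
    Tendsto (fun i => weightedForm (w i) g ∘L (toL2CLM : fracSobolev d s →L[ℝ] L2 d)) l
      (𝓝 (weightedForm w₀ g ∘L toL2CLM)) :=
  tendsto_weightedForm_comp hM hw hw₀ (hlim g) (tendsto_cutoff_closedBall g) fun n =>
    isCompactOperator_cutoff_toL2CLM hs n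

theorem tendsto_resolventForm_apply (hs : 0 < s) (hM : 0 ≤ M)
    {κ : ι → Euc d × Euc d → ℝ} {κ₀ : Euc d × Euc d → ℝ}
    (hκ : ∀ i p, |κ i p| ≤ M) (hκ₀ : ∀ p, |κ₀ p| ≤ M)
    (hκlim : ∀ g h : L2Pair d,
      Tendsto (fun i => weightedForm (κ i) g h) l (𝓝 (weightedForm κ₀ g h)))
    {w : ι → Euc d → ℝ} {w₀ : Euc d → ℝ} (hw : ∀ i x, |w i x| ≤ M) (hw₀ : ∀ x, |w₀ x| ≤ M)
    (hwlim : ∀ g h : L2 d, Tendsto (fun i => weightedForm (w i) g h) l (𝓝 (weightedForm w₀ g h)))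
    (u : fracSobolev d s) :
    Tendsto (fun i => resolventForm (κ i) (w i) m u) l (𝓝 (resolventForm κ₀ w₀ m u)) := by
  simp only [resolventForm_apply]
  have hD := tendsto_weightedForm_comp hM hκ hκ₀ (hκlim (diffQuot u))
    (tendsto_cutoff_separatedPairs u) fun n =>
      isCompactOperator_cutoff_diffQuot hs (by positivity : (0 : ℝ) < 1 / (n + 1)) n
  exact (hD.const_smul _).add
    ((tendsto_weightedForm_comp_toL2CLM hs hM hw hw₀ hwlim (toL2CLM u)).const_smul m)

end StrongConvergence

section Homogenization

variable {d : ℕ} {α m c M : ℝ} {f : L2 d} {Λε : ℝ → Euc d → Euc d → ℝ} {νε : ℝ → Euc d → ℝ}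
  {Λeff : Euc d → Euc d → ℝ} {k : Euc d × Euc d → Euc d × Euc d → ℝ} {ν : Euc d → ℝ} {γ : ℝ}

/-- The common structure of the two cases of the theorem: the symmetrized kernels
`Λ^ε(x,y) ν^ε(x)` are the rescalings of one locally periodic kernel `k`, the weights `ν^ε` are the
rescalings of one periodic function `ν`, both lie between `c` and `M`, and `Λ^eff` is the ratio of
their averages. -/
structure IsSymmetrizedBy (Λε : ℝ → Euc d → Euc d → ℝ) (νε : ℝ → Euc d → ℝ)
    (Λeff : Euc d → Euc d → ℝ) (k : Euc d × Euc d → Euc d × Euc d → ℝ) (ν : Euc d → ℝ)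
    (c M : ℝ) : Prop where
  kernel : IsLocallyPeriodic volume (pairPeriods d) M k
  weight : IsLocallyPeriodic volume
    (Set.range (EuclideanSpace.basisFun (Fin d) ℝ).toBasis) M fun _ => ν
  pos : 0 < c
  le_kernel : ∀ p q, c ≤ k p q
  le_weight : ∀ x, c ≤ ν x
  coeff_mul_weight : ∀ ε p, Λε ε p.1 p.2 * νε ε p.1 = k p (ε⁻¹ • p)
  weight_eq : ∀ ε x, νε ε x = ν (ε⁻¹ • x)
  average_mul_eff : ∀ p : Euc d × Euc d, (∫ ξ in unitCell d, ν ξ) * Λeff p.1 p.2 =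
    ∫ q in unitCell d ×ˢ unitCell d, k p q

namespace IsSymmetrizedBy

theorem isResolventSolution_iff (h : IsSymmetrizedBy Λε νε Λeff k ν c M) {ε : ℝ} (hε : 0 < ε)
    {u : fracSobolev d (α / 2)} :
    IsResolventSolution α (Λε ε) (νε ε) m f u ↔
      resolventForm (fun p => k p (ε⁻¹ • p)) (fun x => ν (ε⁻¹ • x)) m u =
        -(weightedForm (fun x => ν (ε⁻¹ • x)) f ∘L toL2CLM) := by
  have hκ : (fun p : Euc d × Euc d => Λε ε p.1 p.2 * νε ε p.1) = fun p => k p (ε⁻¹ • p) :=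
    funext (h.coeff_mul_weight ε)
  have hν : νε ε = fun x => ν (ε⁻¹ • x) := funext (h.weight_eq ε)
  rw [LevyHomogenization.isResolventSolution_iff (hκ ▸ h.kernel.memLp_rescaled hε.ne')
    (hν ▸ h.weight.memLp_rescaled hε.ne'), hκ, hν]

theorem isResolventSolution_eff_iff (h : IsSymmetrizedBy Λε νε Λeff k ν c M)
    {u : fracSobolev d (α / 2)} :
    IsResolventSolution α Λeff (fun _ => 1) m f u ↔
      resolventForm (fun p => ∫ q in unitCell d ×ˢ unitCell d, k p q)
          (fun _ => ∫ ξ in unitCell d, ν ξ) m u =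
        -(weightedForm (fun _ => ∫ ξ in unitCell d, ν ξ) f ∘L toL2CLM) := by
  have hν₀ : (∫ ξ in unitCell d, ν ξ) ≠ 0 :=
    (h.pos.trans_le (h.weight.le_average (isAveragingCell_unitCell d)
      (fun _ => h.le_weight) 0)).ne'
  have hκ : (fun p : Euc d × Euc d => Λeff p.1 p.2 * ∫ ξ in unitCell d, ν ξ) =
      fun p => ∫ q in unitCell d ×ˢ unitCell d, k p q :=
    funext fun p => (mul_comm _ _).trans (h.average_mul_eff p)
  rw [← isResolventSolution_const_mul_iff hν₀]
  simp only [mul_one]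
  rw [LevyHomogenization.isResolventSolution_iff
    (hκ ▸ h.kernel.memLp_average (isAveragingCell_pair d))
    (h.weight.memLp_average (isAveragingCell_unitCell d)), hκ]

theorem existsUnique_isResolventSolution (h : IsSymmetrizedBy Λε νε Λeff k ν c M) (hm : 0 < m)
    (f : L2 d) {ε : ℝ} (hε : 0 < ε) :
    ∃! u : fracSobolev d (α / 2), IsResolventSolution α (Λε ε) (νε ε) m f u := by
  simp only [h.isResolventSolution_iff hε]
  exact existsUnique_resolventForm_eq (h.kernel.memLp_rescaled hε.ne')
    (h.weight.memLp_rescaled hε.ne') h.pos (fun _ => h.le_kernel _ _) (fun _ => h.le_weight _) hm _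

theorem existsUnique_isResolventSolution_eff (h : IsSymmetrizedBy Λε νε Λeff k ν c M)
    (hm : 0 < m) (f : L2 d) :
    ∃! u : fracSobolev d (α / 2), IsResolventSolution α Λeff (fun _ => 1) m f u := by
  simp only [h.isResolventSolution_eff_iff]
  exact existsUnique_resolventForm_eq (h.kernel.memLp_average (isAveragingCell_pair d))
    (h.weight.memLp_average (isAveragingCell_unitCell d)) h.pos
    (h.kernel.le_average (isAveragingCell_pair d) h.le_kernel)
    (h.weight.le_average (isAveragingCell_unitCell d) fun _ => h.le_weight) hm _

theorem tendsto_isResolventSolution (h : IsSymmetrizedBy Λε νε Λeff k ν c M) (hα : 0 < α)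
    (hm : 0 < m) {u : ℝ → fracSobolev d (α / 2)} {u₀ : fracSobolev d (α / 2)}
    (hu : ∀ ε : ℝ, 0 < ε → IsResolventSolution α (Λε ε) (νε ε) m f (u ε))
    (hu₀ : IsResolventSolution α Λeff (fun _ => 1) m f u₀) : Tendsto u (𝓝[>] 0) (𝓝 u₀) := by
  have hpair := isAveragingCell_pair d
  have hcell := isAveragingCell_unitCell d
  have hM := h.kernel.bound_nonneg
  have hc := h.pos
  have hpos : ∀ᶠ ε : ℝ in 𝓝[>] 0, 0 < ε := self_mem_nhdsWithin
  have hsource := tendsto_weightedForm_comp_toL2CLM (half_pos hα) hM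
    (fun ε x => h.weight.abs_le 0 (ε⁻¹ • x)) (h.weight.abs_average_le hcell)
    (hcell.tendsto_weightedForm_rescaled h.weight) f
  have hform := tendsto_resolventForm_apply (m := m) (half_pos hα) hM
    (fun ε p => h.kernel.abs_le p (ε⁻¹ • p)) (h.kernel.abs_average_le hpair)
    (hpair.tendsto_weightedForm_rescaled h.kernel)
    (fun ε x => h.weight.abs_le 0 (ε⁻¹ • x)) (h.weight.abs_average_le hcell)
    (hcell.tendsto_weightedForm_rescaled h.weight) u₀
  rw [h.isResolventSolution_eff_iff.1 hu₀] at hform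
  refine tendsto_of_coercive (c := c * min (1 / 2) m) (by positivity) ?_ ?_ hform hsource.neg
  · filter_upwards [hpos] with ε hε
    exact le_resolventForm_self (h.kernel.memLp_rescaled hε.ne') (h.weight.memLp_rescaled hε.ne')
      hc.le (fun _ => h.le_kernel _ _) (fun _ => h.le_weight _) hm.le
  · filter_upwards [hpos] with ε hε
    exact (h.isResolventSolution_iff hε).1 (hu ε hε)

end IsSymmetrizedBy

theorem UnitPeriodic.isLocallyPeriodic (hh : UnitPeriodic ν) (hm : AEMeasurable ν)
    (hM : ∀ x, |ν x| ≤ M) :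
    IsLocallyPeriodic volume (Set.range (EuclideanSpace.basisFun (Fin d) ℝ).toBasis) M
      fun _ => ν where
  continuous _ := continuous_const
  aemeasurable _ := hm
  periodic _ := hh.add_basis
  abs_le _ := hM

theorem UnitPeriodic.isLocallyPeriodic_mul (hh : UnitPeriodic ν) (hm : AEMeasurable ν)
    (hM : ∀ x, |ν x| ≤ M) :
    IsLocallyPeriodic volume (pairPeriods d) (M * M) fun _ q => ν q.1 * ν q.2 where
  continuous _ := continuous_const
  aemeasurable _ :=
    (hm.comp_quasiMeasurePreserving Measure.quasiMeasurePreserving_fst).mul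
      (hm.comp_quasiMeasurePreserving Measure.quasiMeasurePreserving_snd)
  periodic _ := add_pairPeriods (h := fun q => ν q.1 * ν q.2)
    (fun η i ξ => by simp only [hh i ξ]) fun ξ i η => by simp only [hh i η]
  abs_le _ q := by
    rw [abs_mul]
    exact mul_le_mul (hM _) (hM _) (abs_nonneg _) ((abs_nonneg _).trans (hM q.1))

theorem ProductCase.exists_isSymmetrizedBy (hγ : 0 < γ) (h : ProductCase γ Λε νε Λeff) :
    ∃ k ν c M, IsSymmetrizedBy Λε νε Λeff k ν c M := by
  obtain ⟨lam, mu, hlam, hmu, hlamp, hmup, hlamb, hmub, hΛε, hνε, hΛeff⟩ := h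
  have hγi : 0 < γ⁻¹ := inv_pos.2 hγ
  have hlam0 : ∀ x, 0 < lam x := fun x => hγi.trans_le (hlamb x).1
  have hmu0 : ∀ x, 0 < mu x := fun x => hγi.trans_le (hmub x).1
  have hνc : ∀ x, γ⁻¹ * γ⁻¹ ≤ mu x / lam x := fun x => by
    rw [div_eq_mul_inv]
    exact mul_le_mul (hmub x).1 (inv_anti₀ (hlam0 x) (hlamb x).2) hγi.le (hmu0 x).le
  have hνM : ∀ x, |mu x / lam x| ≤ γ * γ := fun x => by
    rw [abs_of_pos (div_pos (hmu0 x) (hlam0 x)), div_eq_mul_inv]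
    exact mul_le_mul (hmub x).2 (inv_le_of_inv_le₀ hγ (hlamb x).1) (inv_pos.2 (hlam0 x)).le hγ.le
  have hνp : UnitPeriodic fun x => mu x / lam x := fun i ξ => by simp only [hmup i ξ, hlamp i ξ]
  have hν := hνp.isLocallyPeriodic (hmu.div hlam) hνM
  have hk := hmup.isLocallyPeriodic_mul hmu fun x => (abs_of_pos (hmu0 x)).trans_le (hmub x).2
  have hc : 0 < γ⁻¹ * γ⁻¹ := by positivity
  have hν₀ : (∫ ξ in unitCell d, mu ξ / lam ξ) ≠ 0 :=
    (hc.trans_le (hν.le_average (isAveragingCell_unitCell d) (fun _ => hνc) 0)).ne'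
  refine ⟨_, _, _, _, hk, hν, hc,
    fun _ q => mul_le_mul (hmub _).1 (hmub _).1 hγi.le (hmu0 _).le, hνc, fun ε p => ?_, hνε,
    fun p => ?_⟩
  · rw [hΛε, hνε, Prod.smul_fst, Prod.smul_snd]
    field_simp [(hlam0 (ε⁻¹ • p.1)).ne']
  · rw [hΛeff, mul_inv_cancel_left₀ hν₀, pow_two]
    exact (setIntegral_prod_mul mu mu (unitCell d) (unitCell d)).symm

theorem LocallyPeriodicCase.exists_isSymmetrizedBy (hγ : 0 < γ)
    (h : LocallyPeriodicCase γ Λε νε Λeff) : ∃ k ν c M, IsSymmetrizedBy Λε νε Λeff k ν c M := by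
  obtain ⟨Λ, hc, hmeas, hp₁, hp₂, -, hb, hΛε, hνε, hΛeff⟩ := h
  have hγi : 0 < γ⁻¹ := inv_pos.2 hγ
  have hγ1 : 1 ≤ γ := by
    by_contra! hlt
    linarith [one_lt_inv₀ hγ |>.2 hlt, hb 0 0 0 0]
  have hcell := isAveragingCell_unitCell d
  have := hcell.isProbabilityMeasure
  have hk : IsLocallyPeriodic volume (pairPeriods d) γ fun p q => Λ p.1 p.2 q.1 q.2 :=
    { continuous := fun q => hc _ _
      aemeasurable := fun p => hmeas _ _
      periodic := fun p => add_pairPeriods (h := fun q => Λ p.1 p.2 q.1 q.2) (hp₁ _ _) (hp₂ _ _)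
      abs_le := fun p q => by
        rw [abs_of_pos (hγi.trans_le (hb _ _ _ _).1)]
        exact (hb _ _ _ _).2 }
  have hν : IsLocallyPeriodic volume (Set.range (EuclideanSpace.basisFun (Fin d) ℝ).toBasis) γ
      fun _ _ => 1 :=
    UnitPeriodic.isLocallyPeriodic (fun _ _ => rfl) aemeasurable_const fun _ => by simpa using hγ1
  refine ⟨_, _, _, _, hk, hν, hγi, fun p q => (hb _ _ _ _).1,
    fun _ => inv_le_one_of_one_le₀ hγ1, fun ε p => ?_, hνε, fun p => ?_⟩
  · rw [hΛε, hνε, mul_one, Prod.smul_fst, Prod.smul_snd]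
  · have hint : Integrable (fun q : Euc d × Euc d => Λ p.1 p.2 q.1 q.2)
        ((volume.restrict (unitCell d)).prod (volume.restrict (unitCell d))) := by
      refine Integrable.of_mem_Icc γ⁻¹ γ ?_ (Eventually.of_forall fun q => hb _ _ _ _)
      rw [Measure.prod_restrict]
      exact (hmeas p.1 p.2).restrict
    have hone : ∫ _ in unitCell d, (1 : ℝ) = 1 := by simp
    rw [hΛeff, hone, one_mul, Measure.volume_eq_prod, ← Measure.prod_restrict,
      integral_prod_symm _ hint]

end Homogenization

end LevyHomogenization

end

theorem theorem1p1_general {d : ℕ} {α : ℝ} (hα : 0 < α) {γ : ℝ} (hγ : 0 < γ)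
    {Λε : ℝ → Euc d → Euc d → ℝ} {νε : ℝ → Euc d → ℝ} {Λeff : Euc d → Euc d → ℝ}
    (hΛ : ProductCase γ Λε νε Λeff ∨ LocallyPeriodicCase γ Λε νε Λeff)
    {m : ℝ} (hm : 0 < m) (f : L2 d) :
    (∀ ε : ℝ, 0 < ε → ∃! u : fracSobolev d (α / 2),
      IsResolventSolution α (Λε ε) (νε ε) m f u) ∧
    (∃! u : fracSobolev d (α / 2), IsResolventSolution α Λeff (fun _ => 1) m f u) ∧
    ∀ (u : ℝ → fracSobolev d (α / 2)) (u₀ : fracSobolev d (α / 2)),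
      (∀ ε : ℝ, 0 < ε → IsResolventSolution α (Λε ε) (νε ε) m f (u ε)) →
      IsResolventSolution α Λeff (fun _ => 1) m f u₀ → Tendsto u (𝓝[>] 0) (𝓝 u₀) := by
  obtain ⟨k, ν, c, M, h⟩ : ∃ k ν c M, IsSymmetrizedBy Λε νε Λeff k ν c M :=
    hΛ.elim (·.exists_isSymmetrizedBy hγ) (·.exists_isSymmetrizedBy hγ)
  exact ⟨fun ε hε => h.existsUnique_isResolventSolution hm f hε,
    h.existsUnique_isResolventSolution_eff hm f,
    fun u u₀ hu hu₀ => h.tendsto_isResolventSolution hα hm hu hu₀⟩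

theorem theorem1p1 (d : ℕ) (hd : 0 < d) (α : ℝ) (hα : α ∈ Set.Ioo (0 : ℝ) 2)
    (γ : ℝ) (hγ : 1 < γ)
    (Λε : ℝ → Euc d → Euc d → ℝ) (νε : ℝ → Euc d → ℝ) (Λeff : Euc d → Euc d → ℝ)
    (hΛ : ProductCase γ Λε νε Λeff ∨ LocallyPeriodicCase γ Λε νε Λeff)
    (m : ℝ) (hm : 0 < m) (f : L2 d) :
    (∀ ε : ℝ, 0 < ε → ∃! u : fracSobolev d (α / 2),
      IsResolventSolution α (Λε ε) (νε ε) m f u) ∧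
    (∃! u : fracSobolev d (α / 2), IsResolventSolution α Λeff (fun _ => 1) m f u) ∧
    ∀ (u : ℝ → fracSobolev d (α / 2)) (u₀ : fracSobolev d (α / 2)),
      (∀ ε : ℝ, 0 < ε → IsResolventSolution α (Λε ε) (νε ε) m f (u ε)) →
      IsResolventSolution α Λeff (fun _ => 1) m f u₀ →
      Tendsto (fun ε => toL2 (u ε)) (𝓝[>] 0) (𝓝 (toL2 u₀)) ∧
      Tendsto (fun ε => toWeakSpace ℝ (fracSobolev d (α / 2)) (u ε)) (𝓝[>] 0)
        (𝓝 (toWeakSpace ℝ (fracSobolev d (α / 2)) u₀)) := by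
  obtain ⟨hε, h₀, hlim⟩ := theorem1p1_general hα.1 (one_pos.trans hγ) hΛ hm f
  refine ⟨hε, h₀, fun u u₀ hu hu₀ => ⟨?_, ?_⟩⟩
  · exact ((toL2CLM (d := d) (s := α / 2)).continuous.tendsto u₀).comp (hlim u u₀ hu hu₀)
  · exact ((toWeakSpaceCLM ℝ (fracSobolev d (α / 2))).continuous.tendsto u₀).comp
      (hlim u u₀ hu hu₀)
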